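/- \textbf{Setting.} For $i,a\in\{0,1\}$ let $V_a^i=H^i|a\rangle\langle a|H^i$ ($H$ the Hadamard matrix). Fix $n\in\mathbb N$ and $f:\{0,1\}^n\times\{0,1\}^n\to\{0,1\}$. In a round of $\mathrm{QPV}_{\mathrm{BB84}}^{\eta,f}$ the verifiers choose $x,y\in\{0,1\}^n$ uniformly at random and measure their qubit with $\{V_0^{f(x,y)},V_1^{f(x,y)}\}$, with outcome $v$. They receive two answers $a,b\in\{0,1,\perp\}$ and record \textsc{Correct} if $a=b=v$, \textsc{Wrong} if $a=b=1-v$, \textsc{No photon} if $a=b=\perp$, and \textsc{Abort} if $a\ne b$. The honest prover with error $p_{err}$ produces these records with probabilities $\eta(1-p_{err}),\ \eta p_{err},\ 1-\eta,\ 0$ (random variable $\mathsf V_P$). \textbf{Attackers.} Alice and Bob hold registers of at most $q$ qubits each. They share with the verifiers an arbitrary pure state $|\psi\rangle$ of the verifiers' qubit and the two registers. Alice applies a unitary $U_A^x$ and Bob a unitary $U_B^y$ to the own register; each sends a part of the own qubits (which qubits may depend on $x$, respectively on $y$) and the own classical input to the other; then they apply POVMs $\{A_a^{xy}\}_a$ and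 $\{B_b^{xy}\}_b$, $a,b\in\{0,1,\perp\}$, to what they now hold and answer with the outcomes. $\mathsf V_{AB}$ is the resulting record for uniformly random $(x,y)$. They \emph{respond with probability $\eta$} if for every $(x,y)$ the record differs from \textsc{No photon} with probability $\eta$. \textbf{The number $\tilde w^\xi(\eta)$.} For $\xi\ge0$, let $\tilde w^{\xi}(\eta)$ be either of the following two numbers. (a) For a state $\phi$ on $\mathbb C^2\otimes\mathcal H_A\otimes\mathcal H_B$ (finite-dimensional) let $\tilde p_\phi^{i,\eta,\xi}$ be $\frac1\eta$ times the supremum of $\sum_{a\in\{0,1\}}\langle\phi|V_a^i\otimes A_a\otimes B_a|\phi\rangle$ over POVMs $\{A_a\},\{B_b\}$, $a,b\in\{0,1,\perp\}$, with $\langle A_aB_b\rangle_\phi\le\xi$ for all $a\neq b$ and $|\langle A_\perp B_\perp\rangle_\phi-(1-\eta)|\le\xi$ (a supremum over no POVMs is $0$). Then $\tilde w^\xi(\eta)=\sup_\phi\frac12(\tilde p_\phi^{0,\eta,\xi}+\tilde p_\phi^{1,\eta,\xi})$. (b) For $p\in[0,1]$ and a level $\ell\ge1$ let $\tilde p_{ans}(p)$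 be the value of the semidefinite program: maximise $\frac12\sum_{x,a\in\{0,1\}}P(a,a|x,x)$ over non-negative $P(a,b|x,x')=\langle A_a^xB_b^{x'}\rangle$ ($a,b\in\{0,1,\perp\}$, $x,x'\in\{0,1\}$) in the level-$\ell$ set $\mathcal Q_\ell$ of the Navascu\'es--Pironio--Ac\'in hierarchy such that $P(a,b|x,x)\le\xi$ for all $a\ne b$ and all $x$, and, for all $x,x'$, $$\sum_{a,b\in\{0,1\}}\bigl(2-\|V_a^x+V_b^{x'}\|\bigr)P(a,b|x,x')\le p\sum_{a\in\{0,1\}}\bigl(4\xi+P(a,a|x,x)+P(a,a|x',x')\bigr).$$ Then $\tilde w^\xi(\eta)=1-\inf\{p\in[0,1]:\tilde p_{ans}(p)\ge\eta-\xi\}$. \textbf{Theorem.} Let $\eta\in(0.509,1]$, $\Delta=0.013$, $\xi=0.005$ and let $n,q\in\mathbb N$ satisfy $q\le\frac n2-5$. With probability at least $1-2^{-2^n}$, a uniformly random function $f:\{0,1\}^n\times\{0,1\}^n\to\{0,1\}$ has the following property. For all attackers as above who respond with probability $\eta$, and for both choices (a) and (b) (with every $\ell\ge1$) of $\tilde w^\xi(\eta)$,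 $$\mathbb P[\mathsf V_{AB}\ne\textsc{Correct}\mid\mathsf V_{AB}\ne\textsc{No photon}]\ \ge\ \tfrac14\bigl[1-(\tilde w^{\xi}(\eta)+\Delta)\bigr].$$ Moreover, if $p_{err}\in[0,1]$ and $p_{err}<\frac14[1-(\tilde w^{\xi}(\eta)+\Delta)]$, then $$\mathbb P[\mathsf V_{AB}=\textsc{Correct}\mid\mathsf V_{AB}\ne\textsc{No photon}]<\mathbb P[\mathsf V_P=\textsc{Correct}\mid\mathsf V_P\ne\textsc{No photon}]=1-p_{err}.$$ -/

import Mathlib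

open scoped Kronecker ComplexOrder

/-! ### Quantum states and measurements on finite-dimensional systems

A system is given by a finite type `ι` of basis labels; its Hilbert space is `ι → ℂ`. -/

namespace LossyBB84

/-- Answers in `{0, 1, ⊥}`: `some a` is the bit `a`, `none` is `⊥` (photon lost). -/
abbrev Answer := Option Bool

/-- `φ` is a unit vector. -/
def IsState {ι : Type*} [Fintype ι] (φ : ι → ℂ) : Prop :=
  ∑ i, ‖φ i‖ ^ 2 = 1

/-- `⟨φ| M |φ⟩ = tr(|φ⟩⟨φ| M)` (a real number when `M` is Hermitian). -/
noncomputable def expect {ι : Type*} [Fintype ι] (φ : ι → ℂ) (M : Matrix ι ι ℂ) : ℝ :=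
  (star φ ⬝ᵥ (M.mulVec φ)).re

/-- A POVM with outcomes `{0, 1, ⊥}` on the system `ι`. -/
structure POVM (ι : Type*) [Fintype ι] [DecidableEq ι] where
  op : Answer → Matrix ι ι ℂ
  posSemidef : ∀ a, (op a).PosSemidef
  sum_eq_one : ∑ a, op a = 1

/-- The Hadamard matrix. -/
noncomputable def hadamard : Matrix Bool Bool ℂ :=
  Matrix.of fun a b => (if a && b then (-1 : ℂ) else 1) / (Real.sqrt 2 : ℂ)

/-- The verifiers' projector `V_a^i = H^i |a⟩⟨a| H^i`: outcome `a` in the computational basis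
(`i = 0`) or in the Hadamard basis (`i = 1`). -/
noncomputable def verifierProj (i a : Bool) : Matrix Bool Bool ℂ :=
  hadamard ^ i.toNat * Matrix.single a a 1 * hadamard ^ i.toNat

section Tripartite

/-! Verifier's qubit, Alice's system `α`, Bob's system `β`, in the state `φ`. -/

variable {α β : Type*} [Fintype α] [Fintype β] [DecidableEq α] [DecidableEq β]

/-- Probability that Alice answers `a` and Bob answers `b`. -/
noncomputable def jointProb (φ : Bool × (α × β) → ℂ) (A : POVM α) (B : POVM β)
    (a b : Answer) : ℝ :=
  expect φ ((1 : Matrix Bool Bool ℂ) ⊗ₖ (A.op a ⊗ₖ B.op b))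

/-- Probability that the verifier's outcome in basis `i` is `v` while Alice answers `a` and Bob
answers `b`. -/
noncomputable def fullProb (i : Bool) (φ : Bool × (α × β) → ℂ) (A : POVM α) (B : POVM β)
    (v : Bool) (a b : Answer) : ℝ :=
  expect φ (verifierProj i v ⊗ₖ (A.op a ⊗ₖ B.op b))

/-- Both answers equal the verifier's outcome. -/
noncomputable def correctProb (i : Bool) (φ : Bool × (α × β) → ℂ) (A : POVM α) (B : POVM β) : ℝ :=
  ∑ v : Bool, fullProb i φ A B v (some v) (some v)

/-- Both answers equal the complement of the verifier's outcome. -/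
noncomputable def wrongProb (i : Bool) (φ : Bool × (α × β) → ℂ) (A : POVM α) (B : POVM β) : ℝ :=
  ∑ v : Bool, fullProb i φ A B v (some (!v)) (some (!v))

/-- Both answers are `⊥`. -/
noncomputable def noPhotonProb (φ : Bool × (α × β) → ℂ) (A : POVM α) (B : POVM β) : ℝ :=
  jointProb φ A B none none

/-- The two answers differ. -/
noncomputable def abortProb (φ : Bool × (α × β) → ℂ) (A : POVM α) (B : POVM β) : ℝ :=
  ∑ a : Answer, ∑ b : Answer, if a ≠ b then jointProb φ A B a b else 0

/-- The measurements admitted in the relaxed problem: each pair of different answers has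
probability at most `ξ`, and the probability of `⊥⊥` is within `ξ` of `1 - η`. -/
def RelaxedFeasible (ξ η : ℝ) (φ : Bool × (α × β) → ℂ) (A : POVM α) (B : POVM β) : Prop :=
  (∀ a b : Answer, a ≠ b → jointProb φ A B a b ≤ ξ) ∧
    (1 - η) - ξ ≤ noPhotonProb φ A B ∧ noPhotonProb φ A B ≤ (1 - η) + ξ

/-- `p̃_φ^{i,η,ξ}`: the best probability of being correct on input `i` with the state `φ`,
normalised by `η`, over all admitted measurements. -/
noncomputable def relaxedWin (ξ η : ℝ) (i : Bool) (φ : Bool × (α × β) → ℂ) : ℝ :=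
  1 / η * sSup {r | ∃ (A : POVM α) (B : POVM β),
    RelaxedFeasible ξ η φ A B ∧ r = correctProb i φ A B}

end Tripartite

/-- The least number that bounds `(p̃_φ^{0,η,ξ} + p̃_φ^{1,η,ξ}) / 2` for all states `φ` of the
verifier's qubit, Alice and Bob, of any finite dimension. -/
noncomputable def wTildeOpt (ξ η : ℝ) : ℝ :=
  sSup {r | ∃ (dA dB : ℕ) (φ : Bool × (Fin dA × Fin dB) → ℂ), IsState φ ∧
    r = 1 / 2 * (relaxedWin ξ η false φ + relaxedWin ξ η true φ)}

/-! ### The relaxed semidefinite program over the levels of the NPA hierarchy -/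

/-- The symbols `A_a^x` and `B_b^y`. -/
inductive Letter where
  | alice (x : Bool) (a : Answer)
  | bob (y : Bool) (b : Answer)

/-- `L` gives the entries `Γ(s, t) = L(s† t)` of a level-`ℓ` NPA moment matrix: rows and columns
are the words of length at most `ℓ` in the projectors `A_a^x`, `B_b^y`, the matrix is positive
semidefinite and normalised, and it respects the relations between words that hold for commuting
projective measurements. (Real matrices suffice: the entrywise real part of a complex solution
is a solution.) -/
structure IsMoment (ℓ : ℕ) (L : List Letter → ℝ) : Prop where
  normalized : L [] = 1
  idempotent : ∀ (u v : List Letter) (e : Letter), u.length + v.length + 2 ≤ 2 * ℓ →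
    L (u ++ e :: e :: v) = L (u ++ e :: v)
  orthogonal_alice : ∀ (u v : List Letter) (x : Bool) (a a' : Answer), a ≠ a' →
    u.length + v.length + 2 ≤ 2 * ℓ → L (u ++ .alice x a :: .alice x a' :: v) = 0
  orthogonal_bob : ∀ (u v : List Letter) (y : Bool) (b b' : Answer), b ≠ b' →
    u.length + v.length + 2 ≤ 2 * ℓ → L (u ++ .bob y b :: .bob y b' :: v) = 0
  commute : ∀ (u v : List Letter) (x y : Bool) (a b : Answer),
    u.length + v.length + 2 ≤ 2 * ℓ →
    L (u ++ .alice x a :: .bob y b :: v) = L (u ++ .bob y b :: .alice x a :: v)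
  complete_alice : ∀ (u v : List Letter) (x : Bool), u.length + v.length + 1 ≤ 2 * ℓ →
    ∑ a : Answer, L (u ++ .alice x a :: v) = L (u ++ v)
  complete_bob : ∀ (u v : List Letter) (y : Bool), u.length + v.length + 1 ≤ 2 * ℓ →
    ∑ b : Answer, L (u ++ .bob y b :: v) = L (u ++ v)
  posSemidef : (Matrix.of fun s t : {w : List Letter // w.length ≤ ℓ} =>
    L (s.1.reverse ++ t.1)).PosSemidef

/-- `P(a, b | x, y)` belongs to the level-`ℓ` set `Q_ℓ`. -/
def InNPA (ℓ : ℕ) (P : Answer → Answer → Bool → Bool → ℝ) : Prop :=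
  (∀ a b x y, 0 ≤ P a b x y) ∧
    ∃ L : List Letter → ℝ, IsMoment ℓ L ∧ ∀ a b x y, P a b x y = L [.alice x a, .bob y b]

/-- Operator norm of a complex matrix acting on the Hilbert space. -/
noncomputable def opNorm (M : Matrix Bool Bool ℂ) : ℝ :=
  ‖Matrix.toEuclideanCLM (n := Bool) (𝕜 := ℂ) M‖

/-- The constraints of the relaxed program with measurement error `perr`. -/
def SDPFeasible (ℓ : ℕ) (ξ perr : ℝ) (P : Answer → Answer → Bool → Bool → ℝ) : Prop :=
  InNPA ℓ P ∧
    (∀ (x : Bool) (a b : Answer), a ≠ b → P a b x x ≤ ξ) ∧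
    ∀ x x' : Bool,
      ∑ a : Bool, ∑ b : Bool,
          (2 - opNorm (verifierProj x a + verifierProj x' b)) * P (some a) (some b) x x' ≤
        perr * ∑ a : Bool,
          (4 * ξ + P (some a) (some a) x x + P (some a) (some a) x' x')

/-- The value of the relaxed program: the largest answering probability at error `perr`. -/
noncomputable def sdpAnswerProb (ℓ : ℕ) (ξ perr : ℝ) : ℝ :=
  sSup {r | ∃ P, SDPFeasible ℓ ξ perr P ∧
    r = 1 / 2 * ∑ x : Bool, ∑ a : Bool, P (some a) (some a) x x}

/-- The bound on the winning probability read off from the relaxed program: `1 - perr` for the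
smallest error `perr` at which the answering probability can reach `η`, up to `ξ`. -/
noncomputable def wTildeSDP (ℓ : ℕ) (ξ η : ℝ) : ℝ :=
  1 - sInf {perr | perr ∈ Set.Icc (0 : ℝ) 1 ∧ η - ξ ≤ sdpAnswerProb ℓ ξ perr}

/-! ### The protocol and its attacks -/

/-- Bit strings of length `n`. -/
abbrev BitString (n : ℕ) := Fin n → Bool

/-- Basis labels of a register whose qubits are labelled by `κ`. -/
abbrev Qubits (κ : Type) := κ → Bool

/-- Qubits of a register that belong to `s`. -/
abbrev Inside {m : ℕ} (s : Finset (Fin m)) := Qubits {i : Fin m // i ∈ s}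

/-- Qubits of a register that do not belong to `s`. -/
abbrev Outside {m : ℕ} (s : Finset (Fin m)) := Qubits {i : Fin m // i ∉ s}

/-- Put the two parts of a register back together. -/
def merge {m : ℕ} (s : Finset (Fin m)) (u : Inside s) (v : Outside s) : Qubits (Fin m) :=
  (Equiv.piEquivPiSubtypeProd (fun i => i ∈ s) (fun _ => Bool)).symm (u, v)

/-- A strategy of attackers who hold at most `q` qubits each. They share with the verifier a pure
state `ψ`; on `x` Alice applies `UA x` to her register and sends the qubits in `sentA x` to Bob;
on `y` Bob applies `UB y` and sends the qubits in `sentB y` to Alice; then both, knowing `x` and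
`y`, measure what they have (Alice: what she kept and what Bob sent, and vice versa). -/
structure Strategy (n q : ℕ) where
  qA : ℕ
  qB : ℕ
  qA_le : qA ≤ q
  qB_le : qB ≤ q
  ψ : Bool × (Qubits (Fin qA) × Qubits (Fin qB)) → ℂ
  isState : IsState ψ
  UA : BitString n → Matrix.unitaryGroup (Qubits (Fin qA)) ℂ
  UB : BitString n → Matrix.unitaryGroup (Qubits (Fin qB)) ℂ
  sentA : BitString n → Finset (Fin qA)
  sentB : BitString n → Finset (Fin qB)
  povmA : ∀ x y : BitString n, POVM (Outside (sentA x) × Inside (sentB y))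
  povmB : ∀ x y : BitString n, POVM (Outside (sentB y) × Inside (sentA x))

/-- The verifiers' record of a round. -/
inductive Verdict where
  | correct
  | wrong
  | noPhoton
  | abort

namespace Strategy

variable {n q : ℕ}

/-- The state after the local unitaries. -/
noncomputable def evolved (S : Strategy n q) (x y : BitString n) :
    Bool × (Qubits (Fin S.qA) × Qubits (Fin S.qB)) → ℂ :=
  ((1 : Matrix Bool Bool ℂ) ⊗ₖ
    ((S.UA x : Matrix (Qubits (Fin S.qA)) (Qubits (Fin S.qA)) ℂ) ⊗ₖ
      (S.UB y : Matrix (Qubits (Fin S.qB)) (Qubits (Fin S.qB)) ℂ))).mulVec S.ψ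

/-- The same state, with the qubits grouped by who holds them after the communication. -/
noncomputable def exchanged (S : Strategy n q) (x y : BitString n) :
    Bool × ((Outside (S.sentA x) × Inside (S.sentB y)) ×
      (Outside (S.sentB y) × Inside (S.sentA x))) → ℂ :=
  fun k => S.evolved x y
    (k.1, (merge (S.sentA x) k.2.2.2 k.2.1.1, merge (S.sentB y) k.2.1.2 k.2.2.1))

/-- Distribution of the verdict for given `x` and `y`, in the protocol for the function `f`. -/
noncomputable def lawAt (S : Strategy n q) (f : BitString n → BitString n → Bool)
    (x y : BitString n) : Verdict → ℝ
  | .correct => correctProb (f x y) (S.exchanged x y) (S.povmA x y) (S.povmB x y)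
  | .wrong => wrongProb (f x y) (S.exchanged x y) (S.povmA x y) (S.povmB x y)
  | .noPhoton => noPhotonProb (S.exchanged x y) (S.povmA x y) (S.povmB x y)
  | .abort => abortProb (S.exchanged x y) (S.povmA x y) (S.povmB x y)

/-- Distribution of the verdict `V_AB` for uniformly random `x` and `y`. -/
noncomputable def law (S : Strategy n q) (f : BitString n → BitString n → Bool)
    (v : Verdict) : ℝ :=
  1 / (2 : ℝ) ^ (2 * n) * ∑ x : BitString n, ∑ y : BitString n, S.lawAt f x y v

/-- The attackers respond with probability `η`: whatever `x` and `y` are, the verdict is different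
from "no photon" with probability `η`. -/
def RespondsWith (S : Strategy n q) (f : BitString n → BitString n → Bool) (η : ℝ) : Prop :=
  ∀ x y, S.lawAt f x y .correct + S.lawAt f x y .wrong + S.lawAt f x y .abort = η

end Strategy

/-- Distribution of the verdict `V_P` for the honest prover: the photon arrives with probability
`η`, and then the answer is wrong with probability `perr`. -/
def honestLaw (η perr : ℝ) : Verdict → ℝ
  | .correct => η * (1 - perr)
  | .wrong => η * perr
  | .noPhoton => 1 - η
  | .abort => 0

/-- `P[V = correct | V ≠ no photon]` for a distribution `p` of the verdict. -/
noncomputable def condCorrect (p : Verdict → ℝ) : ℝ :=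
  p .correct / (p .correct + p .wrong + p .abort)

/-- `P[V ≠ correct | V ≠ no photon]` for a distribution `p` of the verdict. -/
noncomputable def condIncorrect (p : Verdict → ℝ) : ℝ :=
  (p .wrong + p .abort) / (p .correct + p .wrong + p .abort)

end LossyBB84

/-! Score a measurement by P(correct) + P(⊥⊥)/√2. This score cannot be high in both bases: for one
state and any two measurements, one per basis, the scores sum to at most 1 + 1/√2
(`expect_scoreMatrix_add_le`). Indeed, drop Bob's effects from the first score and Alice's from the
second. What remains is one joint measurement of Alice's first POVM and Bob's second, and for each
pair of answers the two verifier operators add up to at most 1 + 1/√2.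

Put W = 1/√2 + (1 − 1/√2)/(2η), which is `labelWin`. An attack that answers with probability η and
is correct with probability ηW scores exactly (1 + 1/√2)/2, half of the monogamy bound. So wherever
the conditional error is below 1 − (W + 0.013), the score is above the midpoint by a fixed margin,
and the state after the exchange of qubits determines the basis f(x,y) (`Strategy.score_gt`,
`highScore_iff`).

The margin survives rounding the shared state and the local unitaries to finite nets. The rounded
data, together with the choice of sent qubits, define a function g predicting f; the final
measurements need not be recorded, since g asks whether some measurement scores high. Hence there
are few functions g (`exists_rounding`). If the average error is below a quarter of the threshold,
Markov's inequality makes f differ from some g on fewer than a quarter of the inputs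
(`Strategy.four_mul_card_lt`). The Hamming balls of that radius around all g together contain at
most a fraction 2^(−2^n) of all functions (`card_insecure_le`).

All this uses W and not the numbers w̃. As the claimed bound weakens when w̃ grows, it suffices that
W ≤ w̃. A shared-randomness strategy winning with probability exactly W is feasible in both relaxed
problems (`labelWin_le_wTildeOpt`, `labelWin_le_wTildeSDP`). -/

namespace LossyBB84

/-! ### Expectation values and their continuity in the state. -/

section Expect

variable {ι : Type*} [Fintype ι]

theorem expect_add (φ : ι → ℂ) (M N : Matrix ι ι ℂ) :
    expect φ (M + N) = expect φ M + expect φ N := by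
  simp [expect, Matrix.add_mulVec, dotProduct_add]

theorem expect_sub (φ : ι → ℂ) (M N : Matrix ι ι ℂ) :
    expect φ (M - N) = expect φ M - expect φ N := by
  simp [expect, Matrix.sub_mulVec, dotProduct_sub]

theorem expect_zero (φ : ι → ℂ) : expect φ (0 : Matrix ι ι ℂ) = 0 := by
  simp [expect]

theorem expect_smul (φ : ι → ℂ) (c : ℝ) (M : Matrix ι ι ℂ) :
    expect φ ((c : ℂ) • M) = c * expect φ M := by
  simp [expect, Matrix.smul_mulVec, dotProduct_smul]

theorem expect_sum {κ : Type*} (φ : ι → ℂ) (s : Finset κ) (M : κ → Matrix ι ι ℂ) :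
    expect φ (∑ k ∈ s, M k) = ∑ k ∈ s, expect φ (M k) := by
  classical
  induction s using Finset.induction_on with
  | empty => simp [expect_zero]
  | insert a s ha ih => rw [Finset.sum_insert ha, Finset.sum_insert ha, expect_add, ih]

theorem expect_one [DecidableEq ι] (φ : ι → ℂ) :
    expect φ (1 : Matrix ι ι ℂ) = ∑ i, ‖φ i‖ ^ 2 := by
  simp only [expect, Matrix.one_mulVec, dotProduct, Complex.re_sum]
  refine Finset.sum_congr rfl fun i _ => ?_
  rw [← Complex.normSq_eq_norm_sq, Complex.normSq_apply]
  simp [Complex.mul_re]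

theorem expect_nonneg (φ : ι → ℂ) {M : Matrix ι ι ℂ} (hM : M.PosSemidef) : 0 ≤ expect φ M :=
  (Complex.le_def.1 (hM.dotProduct_mulVec_nonneg φ)).1

theorem expect_mono (φ : ι → ℂ) {M N : Matrix ι ι ℂ} (h : (N - M).PosSemidef) :
    expect φ M ≤ expect φ N := by
  have := expect_nonneg φ h
  rw [expect_sub] at this
  linarith

/-- Continuity of expectation values of an effect `0 ≤ M ≤ 1` in the state. -/
theorem expect_le_add [DecidableEq ι] (φ χ : ι → ℂ) {M : Matrix ι ι ℂ} (hM : M.PosSemidef)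
    (hM1 : ∀ ω : ι → ℂ, expect ω M ≤ ∑ i, ‖ω i‖ ^ 2) (hχ : IsState χ) {t : ℝ} (ht : 0 < t)
    (h : ∑ i, ‖φ i - χ i‖ ^ 2 ≤ t ^ 2) : expect φ M ≤ expect χ M + 2 * t + t ^ 2 := by
  have hχ1 : expect χ M ≤ 1 := (hM1 χ).trans_eq hχ
  have hd : expect (φ - χ) M ≤ t ^ 2 := (hM1 _).trans (by simpa using h)
  have key : ∀ s : ℝ, expect (s • χ + (φ - χ)) M =
      s ^ 2 * expect χ M + s * (expect φ M - expect χ M - expect (φ - χ) M) +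
        expect (φ - χ) M := by
    intro s
    have hs : (s • χ) = (s : ℂ) • χ := by ext; simp
    have e : expect φ M = expect (χ + (φ - χ)) M := by rw [add_sub_cancel]
    rw [e, hs]
    generalize φ - χ = ω
    simp only [expect, star_add, star_smul, Matrix.mulVec_add, Matrix.mulVec_smul, add_dotProduct,
      dotProduct_add, smul_dotProduct, dotProduct_smul, smul_eq_mul, Complex.add_re]
    simp [Complex.mul_re, sq]
    ring
  -- Cauchy–Schwarz in its AM–GM form: positivity at this vector bounds the cross term by t + t, one
  -- t from the expectation in χ and one from the difference.
  have h5 := expect_nonneg ((-t) • χ + (φ - χ)) hM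
  rw [key] at h5
  have h6 : t * (expect φ M - expect χ M - expect (φ - χ) M) ≤ t * (2 * t) := by
    nlinarith [sq_nonneg t]
  have h7 := le_of_mul_le_mul_left h6 ht
  linarith

end Expect

/-! ### The verifiers' projectors and the score operators on the qubit. -/

section Qubit

/-- Coordinates of the unit vector `H^i |a⟩`. -/
noncomputable def verifierVec (i a j : Bool) : ℝ :=
  if i then (if a && j then -1 else 1) * (Real.sqrt 2)⁻¹ else if j = a then 1 else 0

theorem inv_sqrt_two_mul_self : (Real.sqrt 2)⁻¹ * (Real.sqrt 2)⁻¹ = 1 / 2 := by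
  rw [← mul_inv, Real.mul_self_sqrt (by norm_num)]; norm_num

theorem ofReal_inv_sqrt_two_mul_self :
    ((Real.sqrt 2 : ℝ) : ℂ)⁻¹ * ((Real.sqrt 2 : ℝ) : ℂ)⁻¹ = 1 / 2 := by
  rw [← Complex.ofReal_inv, ← Complex.ofReal_mul, inv_sqrt_two_mul_self]
  norm_num

theorem verifierProj_apply (i a j k : Bool) :
    verifierProj i a j k = ((verifierVec i a j * verifierVec i a k : ℝ) : ℂ) := by
  cases i <;> cases a <;> cases j <;> cases k <;>
    simp [verifierProj, verifierVec, hadamard, Matrix.mul_apply, Matrix.single_apply, div_eq_mul_inv]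

theorem verifierProj_eq (i a : Bool) : verifierProj i a =
    Matrix.vecMulVec (fun j => (verifierVec i a j : ℂ)) (star fun j => (verifierVec i a j : ℂ)) := by
  ext j k
  simp [verifierProj_apply, Matrix.vecMulVec_apply]

theorem verifierProj_posSemidef (i a : Bool) : (verifierProj i a).PosSemidef := by
  rw [verifierProj_eq]
  exact Matrix.posSemidef_vecMulVec_self_star _

theorem sum_verifierProj (i : Bool) : ∑ a, verifierProj i a = 1 := by
  have h := ofReal_inv_sqrt_two_mul_self
  ext j k
  cases i <;> cases j <;> cases k <;>
    simp [verifierProj_apply, verifierVec, h] <;> norm_num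

theorem one_sub_verifierProj (i a : Bool) : 1 - verifierProj i a = verifierProj i (!a) := by
  rw [← sum_verifierProj i]
  cases a <;> simp

/-- `1/√2`, the overlap of the two bases. -/
noncomputable def overlap : ℝ := (Real.sqrt 2)⁻¹

theorem overlap_sq : overlap * overlap = 1 / 2 := inv_sqrt_two_mul_self

theorem overlap_pos : 0 < overlap := by unfold overlap; positivity

theorem overlap_gt : 0.7071 < overlap := by
  have := overlap_sq; have := overlap_pos; nlinarith

theorem overlap_lt : overlap < 0.7072 := by
  have := overlap_sq; have := overlap_pos; nlinarith

/-- The sum of two rank-one projectors with overlap 1/√2 has eigenvalues 1 ± 1/√2, so the difference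
has rank one. The entries of the vector `w` are, up to sign, √(1/√2 ± 1/2), whose product is 1/2. -/
theorem posSemidef_sub_add_verifierProj (a b : Bool) :
    ((((1 + overlap : ℝ) : ℂ) • (1 : Matrix Bool Bool ℂ)) -
      (verifierProj false a + verifierProj true b)).PosSemidef := by
  have h1 := overlap_gt
  set u := Real.sqrt (overlap - 1 / 2) with hu
  set v := Real.sqrt (overlap + 1 / 2) with hv
  have huu : u * u = overlap - 1 / 2 := Real.mul_self_sqrt (by linarith)
  have hvv : v * v = overlap + 1 / 2 := Real.mul_self_sqrt (by linarith)
  have huv : u * v = 1 / 2 := by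
    rw [hu, hv, ← Real.sqrt_mul (by linarith), Real.sqrt_eq_iff_mul_self_eq (by nlinarith [overlap_sq])
      (by norm_num)]
    nlinarith [overlap_sq]
  have huu' : (u : ℂ) * u = overlap - 1 / 2 := by
    rw [← Complex.ofReal_mul, huu]; push_cast; rfl
  have hvv' : (v : ℂ) * v = overlap + 1 / 2 := by
    rw [← Complex.ofReal_mul, hvv]; push_cast; rfl
  have huv' : (u : ℂ) * v = 1 / 2 := by
    rw [← Complex.ofReal_mul, huv]; push_cast; rfl
  have hvu' : (v : ℂ) * u = 1 / 2 := by rw [mul_comm]; exact huv'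
  have h := ofReal_inv_sqrt_two_mul_self
  let w : Bool → ℂ := fun j => (if j = a then (u : ℂ) else v) * (if j && !b then -1 else 1)
  have : (((1 + overlap : ℝ) : ℂ) • (1 : Matrix Bool Bool ℂ)) -
      (verifierProj false a + verifierProj true b) = Matrix.vecMulVec w (star w) := by
    ext j k
    cases a <;> cases b <;> cases j <;> cases k <;>
      simp [w, verifierProj_apply, verifierVec, Matrix.vecMulVec_apply, huu', hvv', huv', hvu', h] <;> ring
  rw [this]
  exact Matrix.posSemidef_vecMulVec_self_star _

/-- Verifier's operators paired with the three answers: `V_a^i` for a bit `a`, and `1/√2` for `⊥`. -/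
noncomputable def scoreOp (i : Bool) : Answer → Matrix Bool Bool ℂ
  | some a => verifierProj i a
  | none => (overlap : ℂ) • 1

theorem scoreOp_posSemidef (i : Bool) (a : Answer) : (scoreOp i a).PosSemidef := by
  cases a with
  | none => exact Matrix.PosSemidef.one.smul (by exact_mod_cast overlap_pos.le)
  | some a => exact verifierProj_posSemidef i a

theorem one_sub_scoreOp_posSemidef (i : Bool) (a : Answer) : (1 - scoreOp i a).PosSemidef := by
  cases a with
  | none =>
    have : (1 : Matrix Bool Bool ℂ) - scoreOp i none = ((1 - overlap : ℝ) : ℂ) • 1 := by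
      simp [scoreOp, sub_smul]
    rw [this]
    exact Matrix.PosSemidef.one.smul (by exact_mod_cast (by linarith [overlap_lt] : 0 ≤ 1 - overlap))
  | some a =>
    change (1 - verifierProj i a).PosSemidef
    rw [one_sub_verifierProj]; exact verifierProj_posSemidef _ _

/-- If one answer is ⊥, its operator is the scalar 1/√2 and the other one is at most 1. Any larger
weight for ⊥ would break this case. -/
theorem scoreOp_add_le (a b : Answer) :
    ((((1 + overlap : ℝ) : ℂ) • (1 : Matrix Bool Bool ℂ)) -
      (scoreOp false a + scoreOp true b)).PosSemidef := by
  cases a with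
  | none =>
    have : (((1 + overlap : ℝ) : ℂ) • (1 : Matrix Bool Bool ℂ)) -
        (scoreOp false none + scoreOp true b) = 1 - scoreOp true b := by
      simp only [scoreOp, Complex.ofReal_add, Complex.ofReal_one, add_smul, one_smul]; abel
    rw [this]; exact one_sub_scoreOp_posSemidef _ _
  | some a =>
    cases b with
    | none =>
      have : (((1 + overlap : ℝ) : ℂ) • (1 : Matrix Bool Bool ℂ)) -
          (scoreOp false (some a) + scoreOp true none) = 1 - scoreOp false (some a) := by
        simp only [scoreOp, Complex.ofReal_add, Complex.ofReal_one, add_smul, one_smul]; abel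
      rw [this]; exact one_sub_scoreOp_posSemidef _ _
    | some b => exact posSemidef_sub_add_verifierProj a b

end Qubit

/-! ### The score of a pair of measurements and its monogamy. -/

section Score

variable {α β : Type*} [Fintype α] [Fintype β]

theorem expect_score_term_sum_right [DecidableEq β] (φ : Bool × (α × β) → ℂ) (T : Matrix Bool Bool ℂ)
    (M : Matrix α α ℂ) (B : POVM β) :
    ∑ b, expect φ (T ⊗ₖ (M ⊗ₖ B.op b)) = expect φ (T ⊗ₖ (M ⊗ₖ (1 : Matrix β β ℂ))) := by
  rw [← expect_sum, ← B.sum_eq_one]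
  congr 1
  ext ⟨i, j, k⟩ ⟨i', j', k'⟩
  simp [Matrix.sum_apply, Matrix.kroneckerMap_apply]
  ring

theorem expect_score_term_sum_left [DecidableEq α] (φ : Bool × (α × β) → ℂ) (T : Matrix Bool Bool ℂ)
    (A : POVM α) (M : Matrix β β ℂ) :
    ∑ a, expect φ (T ⊗ₖ (A.op a ⊗ₖ M)) = expect φ (T ⊗ₖ ((1 : Matrix α α ℂ) ⊗ₖ M)) := by
  rw [← expect_sum, ← A.sum_eq_one]
  congr 1
  ext ⟨i, j, k⟩ ⟨i', j', k'⟩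
  simp [Matrix.sum_apply, Matrix.kroneckerMap_apply]
  ring

variable [DecidableEq α] [DecidableEq β]

theorem POVM.one_sub_posSemidef (A : POVM α) (a : Answer) : (1 - A.op a).PosSemidef := by
  classical
  rw [← A.sum_eq_one, ← Finset.add_sum_erase _ _ (Finset.mem_univ a), add_sub_cancel_left]
  exact Matrix.posSemidef_sum _ fun b _ => A.posSemidef b

/-- The operator whose expectation is `correctProb + noPhotonProb / √2`. -/
noncomputable def scoreMatrix (i : Bool) (A : POVM α) (B : POVM β) :
    Matrix (Bool × (α × β)) (Bool × (α × β)) ℂ :=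
  ∑ a : Answer, scoreOp i a ⊗ₖ (A.op a ⊗ₖ B.op a)

theorem scoreMatrix_posSemidef (i : Bool) (A : POVM α) (B : POVM β) :
    (scoreMatrix i A B).PosSemidef :=
  Matrix.posSemidef_sum _ fun a _ =>
    (scoreOp_posSemidef i a).kronecker ((A.posSemidef a).kronecker (B.posSemidef a))

theorem expect_scoreMatrix (i : Bool) (φ : Bool × (α × β) → ℂ) (A : POVM α) (B : POVM β) :
    expect φ (scoreMatrix i A B) = correctProb i φ A B + overlap * noPhotonProb φ A B := by
  rw [scoreMatrix, expect_sum, Fintype.sum_option, add_comm]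
  congr 1
  simp only [scoreOp, noPhotonProb, jointProb, Matrix.smul_kronecker]
  rw [expect_smul]

/-- Each of Bob's effects is at most 1. Discarding them frees Bob's system for the measurement he
uses in the other basis. -/
theorem expect_scoreMatrix_le_left (i : Bool) (φ : Bool × (α × β) → ℂ) (A : POVM α) (B : POVM β) :
    expect φ (scoreMatrix i A B) ≤
      ∑ a, expect φ (scoreOp i a ⊗ₖ (A.op a ⊗ₖ (1 : Matrix β β ℂ))) := by
  rw [scoreMatrix, expect_sum]
  refine Finset.sum_le_sum fun a _ => expect_mono φ ?_
  have : scoreOp i a ⊗ₖ (A.op a ⊗ₖ (1 : Matrix β β ℂ)) - scoreOp i a ⊗ₖ (A.op a ⊗ₖ B.op a) =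
      scoreOp i a ⊗ₖ (A.op a ⊗ₖ (1 - B.op a)) := by
    ext ⟨i, j, k⟩ ⟨i', j', k'⟩
    simp [Matrix.kroneckerMap_apply, mul_sub]
  rw [this]
  exact (scoreOp_posSemidef i a).kronecker ((A.posSemidef a).kronecker (B.one_sub_posSemidef a))

theorem expect_scoreMatrix_le_right (i : Bool) (φ : Bool × (α × β) → ℂ) (A : POVM α) (B : POVM β) :
    expect φ (scoreMatrix i A B) ≤
      ∑ b, expect φ (scoreOp i b ⊗ₖ ((1 : Matrix α α ℂ) ⊗ₖ B.op b)) := by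
  rw [scoreMatrix, expect_sum]
  refine Finset.sum_le_sum fun b _ => expect_mono φ ?_
  have : scoreOp i b ⊗ₖ ((1 : Matrix α α ℂ) ⊗ₖ B.op b) - scoreOp i b ⊗ₖ (A.op b ⊗ₖ B.op b) =
      scoreOp i b ⊗ₖ ((1 - A.op b) ⊗ₖ B.op b) := by
    ext ⟨i, j, k⟩ ⟨i', j', k'⟩
    simp [Matrix.kroneckerMap_apply, mul_sub, sub_mul]
  rw [this]
  exact (scoreOp_posSemidef i b).kronecker ((A.one_sub_posSemidef b).kronecker (B.posSemidef b))

theorem sum_jointProb (φ : Bool × (α × β) → ℂ) (A : POVM α) (B : POVM β) :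
    ∑ a, ∑ b, jointProb φ A B a b = ∑ i, ‖φ i‖ ^ 2 := by
  have : (1 : Matrix (Bool × (α × β)) (Bool × (α × β)) ℂ) =
      (1 : Matrix Bool Bool ℂ) ⊗ₖ ((1 : Matrix α α ℂ) ⊗ₖ (1 : Matrix β β ℂ)) := by
    simp
  simp only [jointProb, expect_score_term_sum_right, expect_score_term_sum_left]
  rw [← this, expect_one]

theorem jointProb_nonneg (φ : Bool × (α × β) → ℂ) (A : POVM α) (B : POVM β) (a b : Answer) :
    0 ≤ jointProb φ A B a b :=
  expect_nonneg _ (Matrix.PosSemidef.one.kronecker ((A.posSemidef a).kronecker (B.posSemidef b)))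

theorem fullProb_nonneg (i : Bool) (φ : Bool × (α × β) → ℂ) (A : POVM α) (B : POVM β)
    (v : Bool) (a b : Answer) : 0 ≤ fullProb i φ A B v a b :=
  expect_nonneg _ ((verifierProj_posSemidef i v).kronecker
    ((A.posSemidef a).kronecker (B.posSemidef b)))

theorem wrongProb_nonneg (i : Bool) (φ : Bool × (α × β) → ℂ) (A : POVM α) (B : POVM β) :
    0 ≤ wrongProb i φ A B := Finset.sum_nonneg fun _ _ => fullProb_nonneg _ _ _ _ _ _ _

theorem abortProb_nonneg (φ : Bool × (α × β) → ℂ) (A : POVM α) (B : POVM β) :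
    0 ≤ abortProb φ A B :=
  Finset.sum_nonneg fun _ _ => Finset.sum_nonneg fun _ _ => by
    split_ifs
    · exact jointProb_nonneg _ _ _ _ _
    · exact le_rfl

theorem noPhotonProb_nonneg (φ : Bool × (α × β) → ℂ) (A : POVM α) (B : POVM β) :
    0 ≤ noPhotonProb φ A B := jointProb_nonneg _ _ _ _ _

theorem sum_fullProb (i : Bool) (φ : Bool × (α × β) → ℂ) (A : POVM α) (B : POVM β)
    (a b : Answer) : ∑ v, fullProb i φ A B v a b = jointProb φ A B a b := by
  simp only [fullProb, jointProb]
  rw [← expect_sum, ← sum_verifierProj i]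
  congr 1
  ext ⟨i, j, k⟩ ⟨i', j', k'⟩
  simp [Matrix.kroneckerMap_apply, add_mul]

theorem verdict_total (i : Bool) (φ : Bool × (α × β) → ℂ) (hφ : IsState φ) (A : POVM α)
    (B : POVM β) : correctProb i φ A B + wrongProb i φ A B + abortProb φ A B +
      noPhotonProb φ A B = 1 := by
  have h := sum_jointProb φ A B
  rw [show ∑ i, ‖φ i‖ ^ 2 = 1 from hφ] at h
  have h0 := sum_fullProb i φ A B (some false) (some false)
  have h1 := sum_fullProb i φ A B (some true) (some true)
  rw [← h]
  simp only [Fintype.sum_option, Fintype.sum_bool, correctProb, wrongProb, abortProb,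
    noPhotonProb] at *
  simp
  linarith

/-- The effect bound `scoreMatrix ≤ 1`. -/
theorem expect_scoreMatrix_le (i : Bool) (φ : Bool × (α × β) → ℂ) (A : POVM α) (B : POVM β) :
    expect φ (scoreMatrix i A B) ≤ ∑ k, ‖φ k‖ ^ 2 := by
  refine (expect_scoreMatrix_le_left i φ A B).trans ?_
  rw [← sum_jointProb φ A B]
  refine Finset.sum_le_sum fun a _ => ?_
  simp only [jointProb, expect_score_term_sum_right]
  apply expect_mono
  have : (1 : Matrix Bool Bool ℂ) ⊗ₖ (A.op a ⊗ₖ (1 : Matrix β β ℂ)) -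
      scoreOp i a ⊗ₖ (A.op a ⊗ₖ (1 : Matrix β β ℂ)) =
      (1 - scoreOp i a) ⊗ₖ (A.op a ⊗ₖ (1 : Matrix β β ℂ)) := by
    ext ⟨i, j, k⟩ ⟨i', j', k'⟩
    simp [Matrix.kroneckerMap_apply, sub_mul]
  rw [this]
  exact (one_sub_scoreOp_posSemidef i a).kronecker ((A.posSemidef a).kronecker .one)

/-- Monogamy: no state allows a high score in both bases. -/
theorem expect_scoreMatrix_add_le (φ : Bool × (α × β) → ℂ) (hφ : IsState φ) (A A' : POVM α)
    (B B' : POVM β) :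
    expect φ (scoreMatrix false A B) + expect φ (scoreMatrix true A' B') ≤ 1 + overlap := by
  calc expect φ (scoreMatrix false A B) + expect φ (scoreMatrix true A' B')
      ≤ ∑ a, ∑ b, expect φ (scoreOp false a ⊗ₖ (A.op a ⊗ₖ B'.op b)) +
          ∑ a, ∑ b, expect φ (scoreOp true b ⊗ₖ (A.op a ⊗ₖ B'.op b)) := by
        -- Resolving the identity on the unused side by the other player's POVM writes both scores
        -- over the same joint effects, Alice's for one basis and Bob's for the other.
        refine add_le_add ?_ ?_
        · simp only [expect_score_term_sum_right]
          exact expect_scoreMatrix_le_left false φ A B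
        · rw [Finset.sum_comm]
          simp only [expect_score_term_sum_left]
          exact expect_scoreMatrix_le_right true φ A' B'
    _ ≤ ∑ a, ∑ b, (1 + overlap) * jointProb φ A B' a b := by
        rw [← Finset.sum_add_distrib]
        refine Finset.sum_le_sum fun a _ => ?_
        rw [← Finset.sum_add_distrib]
        refine Finset.sum_le_sum fun b _ => ?_
        rw [jointProb, ← expect_smul, ← expect_add]
        apply expect_mono
        have : ((1 + overlap : ℝ) : ℂ) • ((1 : Matrix Bool Bool ℂ) ⊗ₖ (A.op a ⊗ₖ B'.op b)) -
            (scoreOp false a ⊗ₖ (A.op a ⊗ₖ B'.op b) + scoreOp true b ⊗ₖ (A.op a ⊗ₖ B'.op b)) =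
            ((((1 + overlap : ℝ) : ℂ) • (1 : Matrix Bool Bool ℂ)) -
              (scoreOp false a + scoreOp true b)) ⊗ₖ (A.op a ⊗ₖ B'.op b) := by
          ext ⟨i, j, k⟩ ⟨i', j', k'⟩
          simp [Matrix.kroneckerMap_apply, sub_mul, add_mul, mul_assoc]
        rw [this]
        exact (scoreOp_add_le a b).kronecker ((A.posSemidef a).kronecker (B'.posSemidef b))
    _ = 1 + overlap := by
        simp only [← Finset.mul_sum]
        rw [sum_jointProb, show ∑ i, ‖φ i‖ ^ 2 = 1 from hφ, mul_one]

end Score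

/-! ### Strategies that measure a shared classical label. -/

section SharedRandomness

variable {κ : Type*} [Fintype κ] [DecidableEq κ]

/-- Alice and Bob share a classical label `k`, and the verifier's qubit is in the (unnormalised,
real) state `amp k`. -/
def labelState (amp : κ → Bool → ℝ) : Bool × (κ × κ) → ℂ :=
  fun x => if x.2.1 = x.2.2 then (amp x.2.1 x.1 : ℂ) else 0

/-- Answer `ans k` on the label `k`. -/
def labelPOVM (ans : κ → Answer) : POVM κ where
  op a := Matrix.diagonal fun k => if ans k = a then 1 else 0
  posSemidef a := Matrix.PosSemidef.diagonal fun k => by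
    dsimp only [Pi.zero_apply]; split_ifs <;> simp
  sum_eq_one := by
    ext i j
    simp only [Matrix.sum_apply, Matrix.diagonal_apply, Matrix.one_apply]
    split_ifs <;> simp

/-- Diagonal effects annihilate the cross terms between different labels, so the coherent
superposition behaves as a classical mixture. -/
theorem expect_labelState (amp : κ → Bool → ℝ) (V : Matrix Bool Bool ℂ) (d d' : κ → ℝ) :
    expect (labelState amp)
      (V ⊗ₖ (Matrix.diagonal (fun k => (d k : ℂ)) ⊗ₖ Matrix.diagonal (fun k => (d' k : ℂ)))) =
      ∑ k, d k * d' k * ∑ j, ∑ j', amp k j * amp k j' * (V j j').re := by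
  have h : ∀ (j j' : Bool) (k k' l l' : κ), (V ⊗ₖ (Matrix.diagonal (fun k => (d k : ℂ)) ⊗ₖ
      Matrix.diagonal (fun k => (d' k : ℂ)))) (j, k, l) (j', k', l') =
      if k' = k then (if l' = l then V j j' * (d k * d' l) else 0) else 0 := by
    intro j j' k k' l l'
    by_cases hk : k = k' <;> by_cases hl : l = l' <;>
      simp [Matrix.kroneckerMap_apply, hk, hl, eq_comm]
  have h2 : ∀ (j : Bool) (k l : κ), ((V ⊗ₖ (Matrix.diagonal (fun k => (d k : ℂ)) ⊗ₖ
      Matrix.diagonal (fun k => (d' k : ℂ)))).mulVec (labelState amp)) (j, k, l) =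
      if k = l then ∑ j', V j j' * (d k * d' k) * amp k j' else 0 := by
    intro j k l
    simp only [Matrix.mulVec, dotProduct, Fintype.sum_prod_type, h, labelState, ite_mul, zero_mul,
      Finset.sum_ite_eq', Finset.mem_univ, if_true, Finset.sum_ite_irrel, Finset.sum_const_zero]
    by_cases hkl : k = l
    · subst hkl; simp
    · simp [hkl]
  simp only [expect, dotProduct, Fintype.sum_prod_type, h2, Pi.star_apply, labelState]
  rw [Finset.sum_comm]
  simp only [Complex.re_sum]
  refine Finset.sum_congr rfl fun k _ => ?_
  rw [Finset.mul_sum]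
  refine Finset.sum_congr rfl fun j _ => ?_
  rw [Finset.sum_eq_single k]
  · simp only [if_true, Complex.star_def, Complex.conj_ofReal, Complex.re_ofReal_mul,
      Complex.re_sum, Finset.mul_sum]
    refine Finset.sum_congr rfl fun j' _ => ?_
    rw [show V j j' * (d k * d' k) * amp k j' = ((d k * d' k * amp k j' : ℝ) : ℂ) * V j j' by
      push_cast; ring, Complex.re_ofReal_mul]
    ring
  · intro l _ hl
    simp [Ne.symm hl]
  · simp

theorem isState_labelState {amp : κ → Bool → ℝ} (h : ∑ k, ∑ j, amp k j ^ 2 = 1) :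
    IsState (labelState amp) := by
  rw [IsState, ← h]
  simp only [Fintype.sum_prod_type, labelState]
  rw [Finset.sum_comm]
  refine Finset.sum_congr rfl fun k _ => Finset.sum_congr rfl fun j _ => ?_
  rw [Finset.sum_eq_single k]
  · simp
  · intro l _ hl
    simp [Ne.symm hl]
  · simp

theorem labelPOVM_op (ans : κ → Answer) (a : Answer) : (labelPOVM ans).op a =
    Matrix.diagonal fun k => (((if ans k = a then 1 else 0 : ℝ)) : ℂ) := by
  simp only [labelPOVM]
  congr 1
  ext k
  split_ifs <;> simp

theorem jointProb_labelState (amp : κ → Bool → ℝ) (s t : κ → Answer) (a b : Answer) :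
    jointProb (labelState amp) (labelPOVM s) (labelPOVM t) a b =
      ∑ k, (if s k = a then 1 else 0) * (if t k = b then 1 else 0) * ∑ j, amp k j ^ 2 := by
  rw [jointProb, labelPOVM_op, labelPOVM_op, expect_labelState]
  refine Finset.sum_congr rfl fun k _ => ?_
  simp [sq]

theorem correctProb_labelState (i : Bool) (amp : κ → Bool → ℝ) (s : κ → Answer) :
    correctProb i (labelState amp) (labelPOVM s) (labelPOVM s) =
      ∑ v, ∑ k, if s k = some v then (∑ j, amp k j * verifierVec i v j) ^ 2 else 0 := by
  refine Finset.sum_congr rfl fun v _ => ?_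
  rw [fullProb, labelPOVM_op, expect_labelState]
  refine Finset.sum_congr rfl fun k _ => ?_
  split_ifs
  · simp only [verifierProj_apply, Complex.ofReal_re, Fintype.sum_bool]; ring
  · simp

end SharedRandomness

/-! ### A feasible strategy bounding both relaxed values from below. -/

section Witness

/-- Distribution of the shared label: `0` attempts both bases, `1` and `2` guess the basis. -/
def labelWeight (η : ℝ) : Fin 3 → ℝ := ![2 * η - 1, 1 - η, 1 - η]

/-- Answers of either attacker, given the basis and the label. -/
def labelAnswer : Bool → Fin 3 → Answer
  | false => ![some false, some false, none]
  | true => ![some false, none, some false]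

/-- The conditional winning probability `1/√2 + (1 - 1/√2) / (2 η)` of the shared-randomness
strategy. -/
noncomputable def labelWin (η : ℝ) : ℝ := overlap + (1 - overlap) / (2 * η)

/-- The verifier's qubit in the shared-randomness strategy. -/
noncomputable def labelAmp (η : ℝ) (k : Fin 3) (j : Bool) : ℝ :=
  Real.sqrt (labelWeight η k) *
    (![fun j => Real.sqrt ((1 + (if j then -1 else 1) * overlap) / 2),
      fun j => if j then 0 else 1, fun _ => overlap] : Fin 3 → Bool → ℝ) k j

theorem labelWeight_nonneg {η : ℝ} (h : 1 / 2 ≤ η) (h' : η ≤ 1) (k : Fin 3) :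
    0 ≤ labelWeight η k := by
  fin_cases k <;> simp [labelWeight] <;> linarith

theorem sum_labelWeight (η : ℝ) : ∑ k, labelWeight η k = 1 := by
  simp [labelWeight, Fin.sum_univ_three]; ring

theorem sum_sq_labelAmp {η : ℝ} (h : 1 / 2 ≤ η) (h' : η ≤ 1) (k : Fin 3) :
    ∑ j, labelAmp η k j ^ 2 = labelWeight η k := by
  have h0 := overlap_sq
  have h1 := overlap_gt
  have h2 := overlap_lt
  simp only [labelAmp, mul_pow, ← Finset.mul_sum]
  rw [Real.sq_sqrt (labelWeight_nonneg h h' k)]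
  refine (congrArg _ ?_).trans (mul_one _)
  fin_cases k
  · simp only [Fintype.sum_bool]
    simp only [Fin.mk_zero, Matrix.cons_val_zero, if_true, Bool.false_eq_true, if_false]
    rw [Real.sq_sqrt (by linarith), Real.sq_sqrt (by linarith)]
    ring
  · simp
  · simp; nlinarith

/-- Label `0` carries the unit vector halfway between |0⟩ and |+⟩, which wins with probability (1 +
1/√2)/2 in either basis. Labels `1` and `2` carry |0⟩ and |+⟩, which win surely in their own basis
and answer ⊥ in the other. The sum is (2η − 1)(1 + 1/√2)/2 + (1 − η). -/
theorem labelAmp_overlap {η : ℝ} (h : 1 / 2 ≤ η) (h' : η ≤ 1) (i : Bool) :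
    ∑ k, (if labelAnswer i k = some false then
      (∑ j, labelAmp η k j * verifierVec i false j) ^ 2 else 0) = η * labelWin η := by
  have h0 := overlap_sq
  have h1 := overlap_gt
  have h2 := overlap_lt
  have hη : η ≠ 0 := by linarith
  have hW : η * labelWin η = η * overlap + (1 - overlap) / 2 := by
    rw [labelWin]; field_simp
  have hw0 : Real.sqrt (2 * η - 1) ^ 2 = 2 * η - 1 := Real.sq_sqrt (by linarith)
  have hw1 : Real.sqrt (1 - η) ^ 2 = 1 - η := Real.sq_sqrt (by linarith)
  have hc : Real.sqrt ((1 + overlap) / 2) ^ 2 = (1 + overlap) / 2 := Real.sq_sqrt (by linarith)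
  have hs : Real.sqrt ((1 - overlap) / 2) ^ 2 = (1 - overlap) / 2 := Real.sq_sqrt (by linarith)
  have hcs : Real.sqrt ((1 + overlap) / 2) * Real.sqrt ((1 - overlap) / 2) = overlap / 2 := by
    rw [← Real.sqrt_mul (by linarith), Real.sqrt_eq_iff_mul_self_eq (by nlinarith) (by linarith)]
    nlinarith
  rw [hW, Fin.sum_univ_three]
  cases i <;>
  simp only [labelAnswer, labelAmp, labelWeight, verifierVec, Fintype.sum_bool,
    Matrix.cons_val_zero, Matrix.cons_val_one, Matrix.cons_val, if_true, if_false, reduceCtorEq,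
    add_zero, Bool.false_and, Bool.false_eq_true, one_mul, mul_one, mul_zero, zero_add, neg_one_mul,
    ← sub_eq_add_neg, Bool.true_eq_false]
  · rw [mul_pow, hw0, hw1, hc]
    ring
  · rw [show (Real.sqrt 2)⁻¹ = overlap from rfl]
    generalize Real.sqrt ((1 + overlap) / 2) = c at *
    generalize Real.sqrt ((1 - overlap) / 2) = s at *
    calc _ = Real.sqrt (2 * η - 1) ^ 2 * (overlap * overlap) * (s ^ 2 + c ^ 2 + 2 * (c * s)) +
          4 * Real.sqrt (1 - η) ^ 2 * (overlap * overlap) ^ 2 := by ring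
      _ = _ := by rw [hw0, hw1, hs, hc, hcs, h0]; ring

theorem labelAnswer_ne_true (i : Bool) (k : Fin 3) : labelAnswer i k ≠ some true := by
  cases i <;> fin_cases k <;> simp [labelAnswer]

theorem relaxedFeasible_label {ξ η : ℝ} (hξ : 0 ≤ ξ) (h : 1 / 2 ≤ η) (h' : η ≤ 1) (i : Bool) :
    RelaxedFeasible ξ η (labelState (labelAmp η)) (labelPOVM (labelAnswer i))
      (labelPOVM (labelAnswer i)) := by
  have h0 : noPhotonProb (labelState (labelAmp η)) (labelPOVM (labelAnswer i))
      (labelPOVM (labelAnswer i)) = 1 - η := by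
    simp only [noPhotonProb, jointProb_labelState, sum_sq_labelAmp h h', Fin.sum_univ_three]
    cases i <;> simp [labelAnswer, labelWeight]
  refine ⟨fun a b hab => ?_, by rw [h0]; linarith, by rw [h0]; linarith⟩
  rw [jointProb_labelState]
  refine (Finset.sum_eq_zero fun k _ => ?_).trans_le hξ
  by_cases hk : labelAnswer i k = a
  · simp [hk, hab]
  · simp [hk]

section Bounds

variable {α β : Type*} [Fintype α] [Fintype β] [DecidableEq α] [DecidableEq β]

theorem correctProb_le_one (i : Bool) (φ : Bool × (α × β) → ℂ) (hφ : IsState φ) (A : POVM α)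
    (B : POVM β) : correctProb i φ A B ≤ 1 := by
  have := verdict_total i φ hφ A B
  have := wrongProb_nonneg i φ A B
  have := abortProb_nonneg φ A B
  have := noPhotonProb_nonneg φ A B
  linarith

theorem le_relaxedWin {ξ η : ℝ} (hη : 0 < η) (i : Bool) {φ : Bool × (α × β) → ℂ} (hφ : IsState φ)
    {A : POVM α} {B : POVM β} (h : RelaxedFeasible ξ η φ A B) :
    1 / η * correctProb i φ A B ≤ relaxedWin ξ η i φ := by
  refine mul_le_mul_of_nonneg_left (le_csSup ⟨1, ?_⟩ ⟨A, B, h, rfl⟩) (by positivity)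
  rintro _ ⟨A, B, -, rfl⟩
  exact correctProb_le_one i φ hφ A B

theorem relaxedWin_le {ξ η : ℝ} (hη : 0 < η) (i : Bool) {φ : Bool × (α × β) → ℂ}
    (hφ : IsState φ) : relaxedWin ξ η i φ ≤ 1 / η := by
  refine mul_le_of_le_one_right (by positivity) (Real.sSup_le ?_ zero_le_one)
  rintro _ ⟨A, B, -, rfl⟩
  exact correctProb_le_one i φ hφ A B

end Bounds

theorem labelWin_le_wTildeOpt {ξ η : ℝ} (hξ : 0 ≤ ξ) (h : 1 / 2 ≤ η) (h' : η ≤ 1) :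
    labelWin η ≤ wTildeOpt ξ η := by
  have hη : 0 < η := by linarith
  have hφ : IsState (labelState (labelAmp η)) := isState_labelState (by
    simp only [sum_sq_labelAmp h h', sum_labelWeight])
  have hwin : ∀ i, labelWin η ≤ relaxedWin ξ η i (labelState (labelAmp η)) := fun i => by
    refine le_trans (le_of_eq ?_) (le_relaxedWin hη i hφ (relaxedFeasible_label hξ h h' i))
    rw [correctProb_labelState, Fintype.sum_bool, labelAmp_overlap h h' i]
    simp only [labelAnswer_ne_true, if_false, Finset.sum_const_zero, zero_add]
    field_simp
  refine le_trans ?_ (le_csSup ?_ ⟨3, 3, labelState (labelAmp η), hφ, rfl⟩)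
  · linarith [hwin false, hwin true]
  -- Boundedness is essential: a real supremum of an unbounded set would be 0.
  · refine ⟨1 / η, ?_⟩
    rintro _ ⟨dA, dB, φ, hφ, rfl⟩
    linarith [relaxedWin_le (ξ := ξ) hη false hφ, relaxedWin_le (ξ := ξ) hη true hφ]

/-- The deterministic value of a symbol, given the label. -/
def letterValue (k : Fin 3) : Letter → ℝ
  | .alice x a => if labelAnswer x k = a then 1 else 0
  | .bob y b => if labelAnswer y k = b then 1 else 0

/-- Moments of the shared-randomness strategy. -/
noncomputable def labelMoment (η : ℝ) (w : List Letter) : ℝ :=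
  ∑ k, labelWeight η k * (w.map (letterValue k)).prod

theorem finite_letter : Finite Letter :=
  Finite.of_injective (β := Bool × Bool × Answer)
    (fun | .alice x a => (false, x, a) | .bob y b => (true, y, b)) (by
      rintro (⟨x, a⟩ | ⟨x, a⟩) (⟨y, b⟩ | ⟨y, b⟩) h <;> simp_all)

/-- For each label the symbols take commuting values 0 or 1, which satisfy all relations. Word
values are multiplicative and invariant under reversal, so each label contributes a rank-one matrix
and the moment matrix is a mixture of these, at every level. -/
theorem isMoment_labelMoment {η : ℝ} (h : 1 / 2 ≤ η) (h' : η ≤ 1) (ℓ : ℕ) :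
    IsMoment ℓ (labelMoment η) where
  normalized := by simp [labelMoment, sum_labelWeight]
  idempotent u v e _ := by
    refine Finset.sum_congr rfl fun k _ => ?_
    have : letterValue k e * letterValue k e = letterValue k e := by
      cases e <;> simp [letterValue]
    simp only [List.map_append, List.map_cons, List.prod_append, List.prod_cons]
    rw [← mul_assoc (letterValue k e), this]
  orthogonal_alice u v x a a' ha _ := by
    refine Finset.sum_eq_zero fun k _ => ?_
    by_cases hk : labelAnswer x k = a
    · simp [letterValue, hk, ha]
    · simp [letterValue, hk]
  orthogonal_bob u v x a a' ha _ := by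
    refine Finset.sum_eq_zero fun k _ => ?_
    by_cases hk : labelAnswer x k = a
    · simp [letterValue, hk, ha]
    · simp [letterValue, hk]
  commute u v x y a b _ := by
    refine Finset.sum_congr rfl fun k _ => ?_
    simp only [List.map_append, List.map_cons, List.prod_append, List.prod_cons]
    ring
  complete_alice u v x _ := by
    simp only [labelMoment]
    rw [Finset.sum_comm]
    refine Finset.sum_congr rfl fun k _ => ?_
    simp [letterValue, -Fintype.sum_option]
  complete_bob u v x _ := by
    simp only [labelMoment]
    rw [Finset.sum_comm]
    refine Finset.sum_congr rfl fun k _ => ?_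
    simp [letterValue, -Fintype.sum_option]
  posSemidef := by
    have : (Matrix.of fun s t : {w : List Letter // w.length ≤ ℓ} =>
        labelMoment η (s.1.reverse ++ t.1)) = ∑ k, labelWeight η k •
          Matrix.vecMulVec (fun s : {w : List Letter // w.length ≤ ℓ} =>
            (s.1.map (letterValue k)).prod)
          (star fun s : {w : List Letter // w.length ≤ ℓ} => (s.1.map (letterValue k)).prod) := by
      ext s t
      simp [labelMoment, Matrix.sum_apply, Matrix.vecMulVec_apply, List.prod_reverse]
    have := finite_letter
    have : Finite {w : List Letter // w.length ≤ ℓ} := List.finite_length_le Letter ℓ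
    rw [‹Matrix.of _ = _›]
    exact Matrix.posSemidef_sum _ fun k _ =>
      (Matrix.posSemidef_vecMulVec_self_star _).smul (labelWeight_nonneg h h' k)

theorem mulVec_le_opNorm (M : Matrix Bool Bool ℂ) (v : Bool → ℂ) :
    ‖WithLp.toLp 2 (M.mulVec v)‖ ≤ opNorm M * ‖WithLp.toLp 2 v‖ := by
  have := (Matrix.toEuclideanCLM (n := Bool) (𝕜 := ℂ) M).le_opNorm (WithLp.toLp 2 v)
  rwa [Matrix.toEuclideanCLM_toLp] at this

theorem le_opNorm_of_eigenvector {M : Matrix Bool Bool ℂ} {v : Bool → ℂ} {c : ℝ} (hv : v ≠ 0)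
    (hc : 0 ≤ c) (h : M.mulVec v = (c : ℂ) • v) : c ≤ opNorm M := by
  have h1 := mulVec_le_opNorm M v
  rw [h, WithLp.toLp_smul, norm_smul, Complex.norm_real, Real.norm_of_nonneg hc] at h1
  refine le_of_mul_le_mul_right h1 (norm_pos_iff.2 ?_)
  simpa using hv

theorem two_le_opNorm (x : Bool) : 2 ≤ opNorm (verifierProj x false + verifierProj x false) := by
  have hs := ofReal_inv_sqrt_two_mul_self
  refine le_opNorm_of_eigenvector (v := fun j => (verifierVec x false j : ℂ)) ?_ (by norm_num) ?_
  · intro h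
    have := congrFun h false
    cases x <;> simp [verifierVec] at this
  · ext j
    cases x <;> cases j <;>
      simp [Matrix.mulVec, dotProduct, verifierProj_apply, verifierVec, add_mul, hs] <;>
      ring

theorem one_add_overlap_le_opNorm (x x' : Bool) (hx : x ≠ x') :
    1 + overlap ≤ opNorm (verifierProj x false + verifierProj x' false) := by
  have hs := ofReal_inv_sqrt_two_mul_self
  have ho : (overlap : ℂ) * overlap = 1 / 2 := by
    rw [← Complex.ofReal_mul, overlap_sq]; norm_num
  have hpos := overlap_pos
  -- The top eigenvector of the sum of two such projectors is the sum of their unit vectors, here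
  -- |0⟩ + |+⟩.
  refine le_opNorm_of_eigenvector (v := fun j => if j then (overlap : ℂ) else 1 + overlap) ?_
    (by linarith) ?_
  · intro h
    have := congrFun h true
    simp at this
    linarith
  · ext j
    cases x <;> cases x' <;> try contradiction
    all_goals
      cases j <;>
      simp [Matrix.mulVec, dotProduct, verifierProj_apply, verifierVec, hs] <;>
      linear_combination (-1 : ℂ) * ho

/-- Only the answer pair (0,0) occurs among bits. For different bases it comes from label `0` alone,
with weight 2η − 1, and the constraint reduces to (1 − 1/√2)(2η − 1) = 2η(1 − W), up to slack in ξ.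
For equal bases the left side is at most 0. Lower bounds on the operator norms suffice, as they
enter with a negative sign. -/
theorem sdpFeasible_label {ξ η : ℝ} (hξ : 0 ≤ ξ) (h : 1 / 2 ≤ η) (h' : η ≤ 1) (ℓ : ℕ) :
    SDPFeasible ℓ ξ (1 - labelWin η) fun a b x y => labelMoment η [.alice x a, .bob y b] := by
  have h1 := overlap_gt
  have h2 := overlap_lt
  have hη : η ≠ 0 := by linarith
  have hP : ∀ a b x y, labelMoment η [.alice x a, .bob y b] = ∑ k, labelWeight η k *
      ((if labelAnswer x k = a then 1 else 0) * (if labelAnswer y k = b then 1 else 0)) := by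
    intro a b x y
    simp [labelMoment, letterValue]
  have hW : (1 - labelWin η) * (2 * η) = (1 - overlap) * (2 * η - 1) := by
    rw [labelWin]; field_simp; ring
  have hW0 : 0 ≤ 1 - labelWin η := by
    have : 0 ≤ (1 - labelWin η) * (2 * η) := by
      rw [hW]; exact mul_nonneg (by linarith) (by linarith)
    exact nonneg_of_mul_nonneg_left this (by linarith)
  refine ⟨⟨fun a b x y => ?_, labelMoment η, isMoment_labelMoment h h' ℓ, fun _ _ _ _ => rfl⟩,
    fun x a b hab => ?_, fun x x' => ?_⟩
  · simp only [hP]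
    refine Finset.sum_nonneg fun k _ => mul_nonneg (labelWeight_nonneg h h' k) ?_
    split_ifs <;> simp
  · simp only [hP]
    refine (Finset.sum_eq_zero fun k _ => ?_).trans_le hξ
    by_cases hk : labelAnswer x k = a
    · simp [hk, hab]
    · simp [hk]
  · have hd : ∀ x, labelMoment η [.alice x (some false), .bob x (some false)] = η := by
      intro x
      rw [hP, Fin.sum_univ_three]
      cases x <;> simp [labelAnswer, labelWeight] <;> ring
    have ht : ∀ x x' b, labelMoment η [.alice x (some true), .bob x' b] = 0 := by
      intro x x' b
      rw [hP]
      simp [labelAnswer_ne_true]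
    have ht' : ∀ x x' b, labelMoment η [.alice x b, .bob x' (some true)] = 0 := by
      intro x x' b
      rw [hP]
      simp [labelAnswer_ne_true]
    simp only [Fintype.sum_bool, ht, ht', hd, mul_zero, zero_add, add_zero]
    have hrhs : (1 - overlap) * (2 * η - 1) ≤ (1 - labelWin η) * (4 * ξ + (4 * ξ + η + η)) := by
      rw [← hW]
      exact mul_le_mul_of_nonneg_left (by linarith) hW0
    by_cases hx : x = x'
    · subst hx
      rw [hd]
      have := two_le_opNorm x
      have : (2 - opNorm (verifierProj x false + verifierProj x false)) * η ≤ 0 :=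
        mul_nonpos_of_nonpos_of_nonneg (by linarith) (by linarith)
      have : 0 ≤ (1 - overlap) * (2 * η - 1) := mul_nonneg (by linarith) (by linarith)
      linarith
    · have hoff : labelMoment η [.alice x (some false), .bob x' (some false)] = 2 * η - 1 := by
        rw [hP, Fin.sum_univ_three]
        cases x <;> cases x' <;> simp [labelAnswer, labelWeight] at hx ⊢
      rw [hoff]
      refine le_trans ?_ hrhs
      have := one_add_overlap_le_opNorm x x' hx
      exact mul_le_mul_of_nonneg_right (by linarith) (by linarith)

/-- Level one already imposes completeness on words of length two, so P is a normalised
distribution. This makes the supremum in `sdpAnswerProb` genuine. -/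
theorem SDPFeasible.answer_le_one {ℓ : ℕ} (hℓ : 1 ≤ ℓ) {ξ perr : ℝ}
    {P : Answer → Answer → Bool → Bool → ℝ} (h : SDPFeasible ℓ ξ perr P) :
    1 / 2 * ∑ x : Bool, ∑ a : Bool, P (some a) (some a) x x ≤ 1 := by
  obtain ⟨⟨h0, L, hL, hP⟩, -, -⟩ := h
  have hx : ∀ x, ∑ a : Bool, P (some a) (some a) x x ≤ 1 := by
    intro x
    have htot : ∑ a, ∑ b, P a b x x = 1 := by
      have h2 := hL.complete_alice [] [] x (by simp; omega)
      rw [List.nil_append, hL.normalized] at h2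
      rw [← h2]
      refine Finset.sum_congr rfl fun a _ => ?_
      simp only [hP]
      exact hL.complete_bob [.alice x a] [] x (by simp; omega)
    simp only [Fintype.sum_option, Fintype.sum_bool] at htot ⊢
    linarith [h0 none none x x, h0 none (some true) x x, h0 none (some false) x x,
      h0 (some true) none x x, h0 (some true) (some false) x x, h0 (some false) none x x,
      h0 (some false) (some true) x x]
  rw [Fintype.sum_bool]
  linarith [hx true, hx false]

theorem labelWin_le_wTildeSDP {ξ η : ℝ} (hξ : 0 ≤ ξ) (h : 1 / 2 ≤ η) (h' : η ≤ 1) {ℓ : ℕ}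
    (hℓ : 1 ≤ ℓ) : labelWin η ≤ wTildeSDP ℓ ξ η := by
  have h1 := overlap_gt
  have h2 := overlap_lt
  have hη : η ≠ 0 := by linarith
  have hW : (1 - labelWin η) * (2 * η) = (1 - overlap) * (2 * η - 1) := by
    rw [labelWin]; field_simp; ring
  have hW0 : 0 ≤ 1 - labelWin η := by
    have : 0 ≤ (1 - labelWin η) * (2 * η) := by
      rw [hW]; exact mul_nonneg (by linarith) (by linarith)
    exact nonneg_of_mul_nonneg_left this (by linarith)
  have hW1 : 0 ≤ labelWin η := by
    have : 0 ≤ (1 - overlap) / (2 * η) := div_nonneg (by linarith) (by linarith)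
    rw [labelWin]; linarith
  have hans : η ≤ sdpAnswerProb ℓ ξ (1 - labelWin η) := by
    refine le_csSup ⟨1, ?_⟩ ⟨_, sdpFeasible_label hξ h h' ℓ, ?_⟩
    · rintro _ ⟨P, hP, rfl⟩
      exact hP.answer_le_one hℓ
    · simp [labelMoment, letterValue, labelAnswer, labelWeight, Fin.sum_univ_three]
      ring
  have : sInf {perr | perr ∈ Set.Icc (0 : ℝ) 1 ∧ η - ξ ≤ sdpAnswerProb ℓ ξ perr} ≤
      1 - labelWin η :=
    csInf_le ⟨0, fun p hp => hp.1.1⟩ ⟨⟨hW0, by linarith⟩, by linarith⟩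
  rw [wTildeSDP]
  linarith

end Witness

/-! ### Finite nets from volume comparison. -/

section Net

open MeasureTheory Metric Module

variable {E : Type*} [NormedAddCommGroup E] [NormedSpace ℝ E] [FiniteDimensional ℝ E]

/-- The balls of radius δ/2 around the points are disjoint and lie in the ball of radius 1 + δ/2;
compare Haar volumes. -/
theorem card_le_of_separated {δ : ℝ} (hδ : 0 < δ) (s : Finset E) (hs : ∀ c ∈ s, ‖c‖ ≤ 1)
    (h : ∀ c ∈ s, ∀ d ∈ s, c ≠ d → δ ≤ ‖c - d‖) : (s.card : ℝ) ≤ (1 + 2 / δ) ^ finrank ℝ E := by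
  borelize E
  let μ : Measure E := Measure.addHaar
  have D : Set.Pairwise (s : Set E) (Function.onFun Disjoint fun c => ball (c : E) (δ / 2)) := by
    rintro c hc d hd hcd
    apply ball_disjoint_ball
    rw [dist_eq_norm, add_halves]
    exact h c hc d hd hcd
  have hsub : ⋃ c ∈ s, ball (c : E) (δ / 2) ⊆ ball (0 : E) (1 + δ / 2) := by
    refine Set.iUnion₂_subset fun x hx => ball_subset_ball' ?_
    rw [dist_zero_right]
    linarith [hs x hx]
  have I : (s.card : ENNReal) * ENNReal.ofReal ((δ / 2) ^ finrank ℝ E) * μ (ball 0 1) ≤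
      ENNReal.ofReal ((1 + δ / 2) ^ finrank ℝ E) * μ (ball 0 1) :=
    calc
      _ = μ (⋃ c ∈ s, ball (c : E) (δ / 2)) := by
        rw [measure_biUnion_finset D fun c _ => measurableSet_ball]
        simp only [μ.addHaar_ball_of_pos _ (half_pos hδ)]
        simp only [Finset.sum_const, nsmul_eq_mul, mul_assoc]
      _ ≤ μ (ball (0 : E) (1 + δ / 2)) := measure_mono hsub
      _ = _ := by simp only [μ.addHaar_ball_of_pos _ (show 0 < 1 + δ / 2 by positivity)]
  have J : (s.card : ENNReal) * ENNReal.ofReal ((δ / 2) ^ finrank ℝ E) ≤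
      ENNReal.ofReal ((1 + δ / 2) ^ finrank ℝ E) :=
    (ENNReal.mul_le_mul_iff_left (measure_ball_pos _ _ zero_lt_one).ne' measure_ball_lt_top.ne).1 I
  have K := ENNReal.toReal_le_of_le_ofReal (by positivity) J
  rw [ENNReal.toReal_mul, ENNReal.toReal_natCast, ENNReal.toReal_ofReal (by positivity)] at K
  have e : (1 + 2 / δ) ^ finrank ℝ E * (δ / 2) ^ finrank ℝ E = (1 + δ / 2) ^ finrank ℝ E := by
    rw [← mul_pow]
    congr 1
    field_simp
    ring
  rw [← e] at K
  exact le_of_mul_le_mul_right K (by positivity)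

/-- A subset of the unit ball has a net of its own points, of exponential size in the dimension. -/
theorem exists_net (X : Set E) (hX : ∀ x ∈ X, ‖x‖ ≤ 1) :
    ∃ N : Finset E, ↑N ⊆ X ∧ (∀ x ∈ X, ∃ y ∈ N, ‖x - y‖ ≤ 1 / 4000) ∧
      N.card ≤ 2 ^ (13 * finrank ℝ E) := by
  classical
  let good (N : Finset E) : Prop :=
    ↑N ⊆ X ∧ ∀ c ∈ N, ∀ d ∈ N, c ≠ d → 1 / 4000 ≤ ‖c - d‖
  have hbound : ∀ N, good N → N.card ≤ 2 ^ (13 * finrank ℝ E) := fun N hN => by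
    have h := card_le_of_separated (by norm_num) N (fun c hc => hX c (hN.1 hc)) hN.2
    -- 8001 ≤ 8192, the source of the 13 in the exponent.
    have h2 : (1 + 2 / (1 / 4000) : ℝ) ^ finrank ℝ E ≤ (2 ^ 13) ^ finrank ℝ E :=
      pow_le_pow_left₀ (by norm_num) (by norm_num) _
    rw [pow_mul]
    exact_mod_cast h.trans h2
  have hmem : sSup {k | ∃ N, good N ∧ N.card = k} ∈ {k | ∃ N, good N ∧ N.card = k} := by
    refine Nat.sSup_mem ⟨0, ∅, ⟨by simp, by simp⟩, rfl⟩ ⟨2 ^ (13 * finrank ℝ E), ?_⟩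
    rintro _ ⟨N, hN, rfl⟩
    exact hbound N hN
  obtain ⟨N, hN, hcard⟩ := hmem
  refine ⟨N, hN.1, fun x hx => ?_, hbound N hN⟩
  -- A separated subset of the largest cardinality is a net: a point far from all of it could be
  -- added.
  by_contra! hfar
  have hxN : x ∉ N := fun hxN => by
    have := hfar x hxN
    simp at this
    linarith
  have hgood : good (insert x N) := by
    refine ⟨by simpa [Set.insert_subset_iff] using ⟨hx, hN.1⟩, fun c hc d hd hcd => ?_⟩
    rcases Finset.mem_insert.1 hc with rfl | hc' <;> rcases Finset.mem_insert.1 hd with rfl | hd'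
    · exact absurd rfl hcd
    · exact (hfar d hd').le
    · rw [norm_sub_rev]; exact (hfar c hc').le
    · exact hN.2 c hc' d hd' hcd
  have := le_csSup (s := {k | ∃ N, good N ∧ N.card = k}) ⟨2 ^ (13 * finrank ℝ E), by
    rintro _ ⟨N, hN, rfl⟩
    exact hbound N hN⟩ ⟨insert x N, hgood, rfl⟩
  rw [← hcard, Finset.card_insert_of_notMem hxN] at this
  omega

end Net

/-! ### Local unitaries: contraction, perturbation and nets. -/

section Evolution

open scoped Matrix.Norms.L2Operator

variable {m k : Type*} [Fintype m] [Fintype k]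

theorem norm_sq_toLp {ι : Type*} [Fintype ι] (φ : ι → ℂ) :
    ‖WithLp.toLp 2 φ‖ ^ 2 = ∑ i, ‖φ i‖ ^ 2 := EuclideanSpace.norm_sq_eq _

theorem isState_iff_norm {ι : Type*} [Fintype ι] {φ : ι → ℂ} :
    IsState φ ↔ ‖WithLp.toLp 2 φ‖ = 1 := by
  rw [IsState, ← norm_sq_toLp]
  exact pow_eq_one_iff_of_nonneg (norm_nonneg _) two_ne_zero

/-- Apply `A` to Alice's register and `B` to Bob's. -/
noncomputable def localEvolve (A : Matrix m m ℂ) (B : Matrix k k ℂ) (φ : Bool × (m × k) → ℂ) :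
    Bool × (m × k) → ℂ :=
  ((1 : Matrix Bool Bool ℂ) ⊗ₖ (A ⊗ₖ B)).mulVec φ

theorem localEvolve_apply (A : Matrix m m ℂ) (B : Matrix k k ℂ) (φ : Bool × (m × k) → ℂ)
    (b : Bool) (i : m) (j : k) :
    localEvolve A B φ (b, i, j) = ∑ i', ∑ j', A i i' * B j j' * φ (b, i', j') := by
  simp only [localEvolve, Matrix.mulVec, dotProduct, Fintype.sum_prod_type,
    Matrix.kroneckerMap_apply, Matrix.one_apply]
  rw [Finset.sum_eq_single b]
  · simp
  · intro c _ hc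
    simp [Ne.symm hc]
  · simp

variable [DecidableEq m] [DecidableEq k]

/-- The squared norm splits over the other indices, and on each slice the operator acts as `A`. -/
theorem norm_localEvolve_one_right_le (A : Matrix m m ℂ) (φ : Bool × (m × k) → ℂ) :
    ‖WithLp.toLp 2 (localEvolve A (1 : Matrix k k ℂ) φ)‖ ≤ ‖A‖ * ‖WithLp.toLp 2 φ‖ := by
  refine le_of_sq_le_sq ?_ (by positivity)
  rw [mul_pow, norm_sq_toLp, norm_sq_toLp]
  simp only [Fintype.sum_prod_type, Finset.mul_sum]
  refine Finset.sum_le_sum fun b _ => ?_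
  rw [Finset.sum_comm, Finset.sum_comm (s := (Finset.univ : Finset m))]
  refine Finset.sum_le_sum fun j _ => ?_
  have h := Matrix.l2_opNorm_mulVec A (WithLp.toLp 2 fun i => φ (b, i, j))
  have h2 := pow_le_pow_left₀ (norm_nonneg _) h 2
  rw [mul_pow, norm_sq_toLp, EuclideanSpace.norm_sq_eq] at h2
  rw [← Finset.mul_sum]
  refine le_trans (le_of_eq ?_) h2
  refine Finset.sum_congr rfl fun i _ => ?_
  rw [localEvolve_apply]
  simp [Matrix.one_apply, Matrix.mulVec, dotProduct]

theorem norm_localEvolve_one_left_le (B : Matrix k k ℂ) (φ : Bool × (m × k) → ℂ) :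
    ‖WithLp.toLp 2 (localEvolve (1 : Matrix m m ℂ) B φ)‖ ≤ ‖B‖ * ‖WithLp.toLp 2 φ‖ := by
  refine le_of_sq_le_sq ?_ (by positivity)
  rw [mul_pow, norm_sq_toLp, norm_sq_toLp]
  simp only [Fintype.sum_prod_type, Finset.mul_sum]
  refine Finset.sum_le_sum fun b _ => Finset.sum_le_sum fun i _ => ?_
  have h := Matrix.l2_opNorm_mulVec B (WithLp.toLp 2 fun j => φ (b, i, j))
  have h2 := pow_le_pow_left₀ (norm_nonneg _) h 2
  rw [mul_pow, norm_sq_toLp, EuclideanSpace.norm_sq_eq] at h2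
  rw [← Finset.mul_sum]
  refine le_trans (le_of_eq ?_) h2
  refine Finset.sum_congr rfl fun j _ => ?_
  rw [localEvolve_apply]
  simp [Matrix.one_apply, Matrix.mulVec, dotProduct]

theorem norm_localEvolve_le (A : Matrix m m ℂ) (B : Matrix k k ℂ) (φ : Bool × (m × k) → ℂ) :
    ‖WithLp.toLp 2 (localEvolve A B φ)‖ ≤ ‖A‖ * ‖B‖ * ‖WithLp.toLp 2 φ‖ := by
  have : localEvolve A B φ = localEvolve A 1 (localEvolve 1 B φ) := by
    simp only [localEvolve, Matrix.mulVec_mulVec, ← Matrix.mul_kronecker_mul, mul_one, one_mul]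
  rw [this, mul_assoc]
  exact (norm_localEvolve_one_right_le _ _).trans
    (mul_le_mul_of_nonneg_left (norm_localEvolve_one_left_le _ _) (norm_nonneg _))

theorem norm_unitary_le_one {A : Matrix m m ℂ} (hA : A ∈ Matrix.unitaryGroup m ℂ) : ‖A‖ ≤ 1 := by
  rcases isEmpty_or_nonempty m with h | h
  · rw [Subsingleton.elim A 0, norm_zero]; exact zero_le_one
  · exact (CStarRing.norm_of_mem_unitary hA).le

/-- The evolution and its inverse are both contractions, so the norm is preserved. -/
theorem isState_localEvolve {A : Matrix m m ℂ} (hA : A ∈ Matrix.unitaryGroup m ℂ)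
    {B : Matrix k k ℂ} (hB : B ∈ Matrix.unitaryGroup k ℂ) {φ : Bool × (m × k) → ℂ}
    (hφ : IsState φ) : IsState (localEvolve A B φ) := by
  rw [isState_iff_norm] at hφ ⊢
  have hle : ∀ {A : Matrix m m ℂ} {B : Matrix k k ℂ} (χ : Bool × (m × k) → ℂ),
      A ∈ Matrix.unitaryGroup m ℂ → B ∈ Matrix.unitaryGroup k ℂ →
      ‖WithLp.toLp 2 (localEvolve A B χ)‖ ≤ ‖WithLp.toLp 2 χ‖ := by
    intro A B χ hA hB
    refine (norm_localEvolve_le A B χ).trans (mul_le_of_le_one_left (norm_nonneg _) ?_)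
    exact mul_le_one₀ (norm_unitary_le_one hA) (norm_nonneg _) (norm_unitary_le_one hB)
  refine le_antisymm ((hle φ hA hB).trans_eq hφ) ?_
  have hinv : localEvolve (star A) (star B) (localEvolve A B φ) = φ := by
    simp only [localEvolve, Matrix.mulVec_mulVec, ← Matrix.mul_kronecker_mul,
      Matrix.mem_unitaryGroup_iff'.1 hA, Matrix.mem_unitaryGroup_iff'.1 hB]
    simp
  calc (1 : ℝ) = ‖WithLp.toLp 2 (localEvolve (star A) (star B) (localEvolve A B φ))‖ := by
        rw [hinv, hφ]
    _ ≤ _ := hle _ (Unitary.star_mem hA) (Unitary.star_mem hB)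

/-- Telescoping: change the state, then Alice's unitary, then Bob's. The errors add because the
remaining factors are contractions. -/
theorem norm_localEvolve_sub_le {A A' : Matrix m m ℂ} {B B' : Matrix k k ℂ}
    (hA : A ∈ Matrix.unitaryGroup m ℂ) (hA' : A' ∈ Matrix.unitaryGroup m ℂ)
    (hB : B ∈ Matrix.unitaryGroup k ℂ) {φ φ' : Bool × (m × k) → ℂ} (hφ' : IsState φ') :
    ‖WithLp.toLp 2 (localEvolve A B φ - localEvolve A' B' φ')‖ ≤
      ‖WithLp.toLp 2 (φ - φ')‖ + ‖A - A'‖ + ‖B - B'‖ := by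
  have hA1 := norm_unitary_le_one hA
  have hA1' := norm_unitary_le_one hA'
  have hB1 := norm_unitary_le_one hB
  rw [isState_iff_norm] at hφ'
  have e : localEvolve A B φ - localEvolve A' B' φ' =
      localEvolve A B (φ - φ') + localEvolve (A - A') B φ' + localEvolve A' (B - B') φ' := by
    ext ⟨b, i, j⟩
    simp only [Pi.sub_apply, Pi.add_apply, localEvolve_apply, Matrix.sub_apply,
      ← Finset.sum_add_distrib, ← Finset.sum_sub_distrib]
    refine Finset.sum_congr rfl fun _ _ => Finset.sum_congr rfl fun _ _ => ?_
    ring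
  rw [e, WithLp.toLp_add, WithLp.toLp_add]
  refine (norm_add₃_le).trans (add_le_add (add_le_add ?_ ?_) ?_)
  · refine (norm_localEvolve_le _ _ _).trans (mul_le_of_le_one_left (norm_nonneg _) ?_)
    exact mul_le_one₀ hA1 (norm_nonneg _) hB1
  · refine (norm_localEvolve_le _ _ _).trans ?_
    rw [hφ', mul_one]
    exact mul_le_of_le_one_right (norm_nonneg _) hB1
  · refine (norm_localEvolve_le _ _ _).trans ?_
    rw [hφ', mul_one]
    exact mul_le_of_le_one_left (norm_nonneg _) hA1'

/-- A finite net of the unitary matrices. -/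
theorem exists_unitary_net (m : Type*) [Fintype m] [DecidableEq m] :
    ∃ N : Finset (Matrix m m ℂ), (∀ U ∈ N, U ∈ Matrix.unitaryGroup m ℂ) ∧
      (∀ U ∈ Matrix.unitaryGroup m ℂ, ∃ V ∈ N, ‖U - V‖ ≤ 1 / 4000) ∧
      N.card ≤ 2 ^ (26 * Fintype.card m ^ 2) := by
  obtain ⟨N, h1, h2, h3⟩ := exists_net (E := Matrix m m ℂ) (Matrix.unitaryGroup m ℂ : Set _)
    fun U hU => norm_unitary_le_one hU
  refine ⟨N, fun U hU => h1 hU, h2, h3.trans_eq ?_⟩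
  -- The real dimension is twice the complex one, which turns 13 into 26.
  rw [finrank_real_of_complex, Module.finrank_matrix, Module.finrank_self]
  congr 1
  ring

/-- A finite net of the unit vectors. -/
theorem exists_state_net (ι : Type*) [Fintype ι] :
    ∃ N : Finset (EuclideanSpace ℂ ι), (∀ ψ ∈ N, IsState ψ.ofLp) ∧
      (∀ φ : ι → ℂ, IsState φ → ∃ ψ ∈ N, ‖WithLp.toLp 2 (φ - ψ.ofLp)‖ ≤ 1 / 4000) ∧
      N.card ≤ 2 ^ (26 * Fintype.card ι) := by
  obtain ⟨N, h1, h2, h3⟩ := exists_net (E := EuclideanSpace ℂ ι) {ψ | IsState ψ.ofLp}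
    fun ψ hψ => (isState_iff_norm.1 hψ).le
  refine ⟨N, fun U hU => h1 hU, fun φ hφ => h2 (WithLp.toLp 2 φ) hφ, h3.trans_eq ?_⟩
  rw [finrank_real_of_complex, finrank_euclideanSpace]
  congr 1
  ring

end Evolution

/-! ### Regrouping the qubits after the communication. -/

section Exchange

variable {qA qB : ℕ}

/-- Registers before the communication, from the parts held after it. -/
def regroup (s : Finset (Fin qA)) (t : Finset (Fin qB)) :
    Bool × ((Outside s × Inside t) × (Outside t × Inside s)) ≃
      Bool × (Qubits (Fin qA) × Qubits (Fin qB)) where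
  toFun k := (k.1, merge s k.2.2.2 k.2.1.1, merge t k.2.1.2 k.2.2.1)
  invFun k :=
    let u := Equiv.piEquivPiSubtypeProd (fun i => i ∈ s) (fun _ => Bool) k.2.1
    let v := Equiv.piEquivPiSubtypeProd (fun i => i ∈ t) (fun _ => Bool) k.2.2
    (k.1, (u.2, v.1), (v.2, u.1))
  left_inv k := by simp [merge]
  right_inv k := by simp only [merge, Prod.mk.eta, Equiv.symm_apply_apply]

/-- The state of the two registers, grouped by who holds the qubits after the communication. -/
noncomputable def outputState (φ : Bool × (Qubits (Fin qA) × Qubits (Fin qB)) → ℂ)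
    (s : Finset (Fin qA)) (t : Finset (Fin qB)) :
    Bool × ((Outside s × Inside t) × (Outside t × Inside s)) → ℂ :=
  fun k => φ (regroup s t k)

theorem isState_outputState {φ : Bool × (Qubits (Fin qA) × Qubits (Fin qB)) → ℂ} (hφ : IsState φ)
    (s : Finset (Fin qA)) (t : Finset (Fin qB)) : IsState (outputState φ s t) :=
  (Equiv.sum_comp (regroup s t) fun k => ‖φ k‖ ^ 2).trans hφ

theorem Strategy.exchanged_eq {n q : ℕ} (S : Strategy n q) (x y : BitString n) :
    S.exchanged x y = outputState (localEvolve (S.UA x : Matrix _ _ ℂ) (S.UB y : Matrix _ _ ℂ) S.ψ)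
      (S.sentA x) (S.sentB y) := rfl

end Exchange

/-! ### Rounding attacks to a small family of predictors. -/

section Rounding

/-- Some measurements have a score above the threshold in the Hadamard basis. -/
def HighScore {α β : Type*} [Fintype α] [Fintype β] [DecidableEq α] [DecidableEq β]
    (φ : Bool × (α × β) → ℂ) : Prop :=
  ∃ (A : POVM α) (B : POVM β), (1 + overlap) / 2 < expect φ (scoreMatrix true A B)

/-- A state close to one with a good score in basis `i` determines `i`. -/
theorem highScore_iff {α β : Type*} [Fintype α] [Fintype β] [DecidableEq α] [DecidableEq β]
    {φ χ : Bool × (α × β) → ℂ} (hχ : IsState χ) (h : ∑ k, ‖φ k - χ k‖ ^ 2 ≤ (3 / 4000) ^ 2)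
    (i : Bool) (A : POVM α) (B : POVM β)
    (hs : (1 + overlap) / 2 + 0.0016 < expect φ (scoreMatrix i A B)) :
    HighScore χ ↔ i = true := by
  have h1 := expect_le_add φ χ (scoreMatrix_posSemidef i A B)
    (fun ω => expect_scoreMatrix_le i ω A B) hχ (by norm_num) h
  -- At distance 3/4000 the score drops by at most 2 · 3/4000 + (3/4000)², which is below 0.0016.
  have h2 : (1 + overlap) / 2 < expect χ (scoreMatrix i A B) := by
    norm_num at h1 hs ⊢; linarith
  cases i with
  | true => exact iff_of_true ⟨A, B, h2⟩ rfl
  | false =>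
    refine iff_of_false ?_ (by simp)
    rintro ⟨A', B', h3⟩
    -- Scores above the midpoint in both bases would violate monogamy.
    linarith [expect_scoreMatrix_add_le χ hχ A A' B B']

open Classical in
/-- Few functions suffice to predict the basis from the attackers' score, whatever their state,
unitaries and communication. -/
theorem exists_rounding (n qA qB : ℕ) :
    ∃ G : Finset (BitString n → BitString n → Bool),
      G.card ≤ 2 ^ (52 * (2 ^ qA * 2 ^ qB) +
        (26 * (2 ^ qA) ^ 2 + 26 * (2 ^ qB) ^ 2 + qA + qB) * 2 ^ n) ∧
      ∀ (ψ : Bool × (Qubits (Fin qA) × Qubits (Fin qB)) → ℂ), IsState ψ →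
      ∀ (UA : BitString n → Matrix.unitaryGroup (Qubits (Fin qA)) ℂ)
        (UB : BitString n → Matrix.unitaryGroup (Qubits (Fin qB)) ℂ)
        (sA : BitString n → Finset (Fin qA)) (sB : BitString n → Finset (Fin qB)),
      ∃ g ∈ G, ∀ (x y : BitString n) (i : Bool) (A : POVM (Outside (sA x) × Inside (sB y)))
        (B : POVM (Outside (sB y) × Inside (sA x))),
        (1 + overlap) / 2 + 0.0016 < expect (outputState
          (localEvolve (UA x : Matrix _ _ ℂ) (UB y : Matrix _ _ ℂ) ψ) (sA x) (sB y))
          (scoreMatrix i A B) → g x y = i := by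
  obtain ⟨N, hN, hNnet, hNcard⟩ :=
    exists_state_net (Bool × (Qubits (Fin qA) × Qubits (Fin qB)))
  obtain ⟨NA, hNA, hNAnet, hNAcard⟩ := exists_unitary_net (Qubits (Fin qA))
  obtain ⟨NB, hNB, hNBnet, hNBcard⟩ := exists_unitary_net (Qubits (Fin qB))
  -- Alice's data depend on `x` only and Bob's on `y` only, so the count is exponential in 2^n and
  -- not in 2^(2n).
  let F : (N × (BitString n → NA) × (BitString n → NB) × (BitString n → Finset (Fin qA)) ×
      (BitString n → Finset (Fin qB))) → BitString n → BitString n → Bool :=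
    fun d x y => decide (HighScore (outputState
      (localEvolve (d.2.1 x : Matrix _ _ ℂ) (d.2.2.1 y : Matrix _ _ ℂ) d.1.1.ofLp)
      (d.2.2.2.1 x) (d.2.2.2.2 y)))
  refine ⟨Finset.univ.image F, ?_, ?_⟩
  · refine Finset.card_image_le.trans ?_
    simp only [Finset.card_univ, Fintype.card_prod, Fintype.card_pi, Finset.prod_const,
      Fintype.card_coe, Fintype.card_bool, Fintype.card_finset, Fintype.card_fin] at *
    calc _ ≤ 2 ^ (26 * (2 * (2 ^ qA * 2 ^ qB))) * ((2 ^ (26 * (2 ^ qA) ^ 2)) ^ 2 ^ n *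
          ((2 ^ (26 * (2 ^ qB) ^ 2)) ^ 2 ^ n * ((2 ^ qA) ^ 2 ^ n * (2 ^ qB) ^ 2 ^ n))) := by
          gcongr
      _ = _ := by
          simp only [← pow_mul, ← pow_add]
          congr 1
          ring
  · intro ψ hψ UA UB sA sB
    obtain ⟨χ, hχ, hχd⟩ := hNnet ψ hψ
    choose VA hVA hVAd using fun x => hNAnet _ (UA x).2
    choose VB hVB hVBd using fun y => hNBnet _ (UB y).2
    refine ⟨_, Finset.mem_image_of_mem F (Finset.mem_univ
      (⟨χ, hχ⟩, fun x => ⟨VA x, hVA x⟩, fun y => ⟨VB y, hVB y⟩, sA, sB)), ?_⟩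
    intro x y i A B hs
    have hdist := norm_localEvolve_sub_le (UA x).2 (hNA _ (hVA x)) (UB y).2 (B' := VB y)
      (φ := ψ) (hN _ hχ)
    -- One net error of 1/4000 each for the state and the two unitaries.
    have hdist' : ‖WithLp.toLp 2 (localEvolve (UA x : Matrix _ _ ℂ) (UB y : Matrix _ _ ℂ) ψ -
        localEvolve (VA x) (VB y) χ.ofLp)‖ ≤ 3 / 4000 := by
      have := hVAd x
      have := hVBd y
      refine hdist.trans ?_
      linarith
    have hsq := pow_le_pow_left₀ (norm_nonneg _) hdist' 2
    rw [norm_sq_toLp, ← Equiv.sum_comp (regroup (sA x) (sB y))] at hsq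
    have := highScore_iff (isState_outputState
      (isState_localEvolve (hNA _ (hVA x)) (hNB _ (hVB y)) (hN _ hχ)) (sA x) (sB y)) hsq i A B hs
    simp only [F, this]
    simp

end Rounding

/-! ### A successful attack predicts the function on most inputs. -/

section Attack

variable {n q : ℕ} {f : BitString n → BitString n → Bool} {η : ℝ}

theorem Strategy.isState_exchanged (S : Strategy n q) (x y : BitString n) :
    IsState (S.exchanged x y) := by
  rw [S.exchanged_eq]
  exact isState_outputState (isState_localEvolve (S.UA x).2 (S.UB y).2 S.isState) _ _

theorem Strategy.law_answer (S : Strategy n q) (h : S.RespondsWith f η) :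
    S.law f .correct + S.law f .wrong + S.law f .abort = η := by
  have : S.law f .correct + S.law f .wrong + S.law f .abort =
      1 / (2 : ℝ) ^ (2 * n) * ∑ x, ∑ y,
        (S.lawAt f x y .correct + S.lawAt f x y .wrong + S.lawAt f x y .abort) := by
    simp only [Strategy.law, Finset.sum_add_distrib]
    ring
  rw [this]
  simp only [h _ _, Finset.sum_const, Finset.card_univ, Fintype.card_pi, Finset.prod_const,
    Fintype.card_bool, Fintype.card_fin, nsmul_eq_mul]
  push_cast
  rw [two_mul, pow_add]
  field_simp

theorem Strategy.condCorrect_eq (S : Strategy n q) (hη : η ≠ 0) (h : S.RespondsWith f η) :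
    condCorrect (S.law f) = 1 - condIncorrect (S.law f) := by
  rw [condCorrect, condIncorrect, eq_sub_iff_add_eq, ← add_div, ← add_assoc, S.law_answer h,
    div_self hη]

theorem Strategy.condIncorrect_nonneg (S : Strategy n q) (hη : 0 ≤ η) (h : S.RespondsWith f η) :
    0 ≤ condIncorrect (S.law f) := by
  rw [condIncorrect, S.law_answer h]
  refine div_nonneg (add_nonneg ?_ ?_) hη
  · exact mul_nonneg (by positivity) (Finset.sum_nonneg fun x _ => Finset.sum_nonneg fun y _ =>
      wrongProb_nonneg _ _ _ _)
  · exact mul_nonneg (by positivity) (Finset.sum_nonneg fun x _ => Finset.sum_nonneg fun y _ =>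
      abortProb_nonneg _ _ _)

/-- On inputs where the attackers err rarely, their score determines the basis. -/
theorem Strategy.score_gt (S : Strategy n q) (hη : 1 / 2 ≤ η) (h : S.RespondsWith f η)
    (x y : BitString n)
    (hxy : S.lawAt f x y .wrong + S.lawAt f x y .abort < η * (1 - (labelWin η + 0.013))) :
    (1 + overlap) / 2 + 0.0016 <
      expect (S.exchanged x y) (scoreMatrix (f x y) (S.povmA x y) (S.povmB x y)) := by
  have hη0 : η ≠ 0 := by linarith
  have h1 : S.lawAt f x y .correct + S.lawAt f x y .wrong + S.lawAt f x y .abort = η := h x y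
  have h2 : S.lawAt f x y .correct + S.lawAt f x y .wrong + S.lawAt f x y .abort +
      S.lawAt f x y .noPhoton = 1 :=
    verdict_total (f x y) _ (S.isState_exchanged x y) (S.povmA x y) (S.povmB x y)
  have h3 : S.lawAt f x y .noPhoton = 1 - η := by linarith
  rw [expect_scoreMatrix]
  change _ < S.lawAt f x y .correct + overlap * S.lawAt f x y .noPhoton
  rw [h3]
  have hW : η * labelWin η = η * overlap + (1 - overlap) / 2 := by
    rw [labelWin]; field_simp
  norm_num at hxy ⊢
  -- As ηW + (1 − η)/√2 = (1 + 1/√2)/2, the score exceeds the midpoint by more than 0.013η ≥ 0.0065.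
  nlinarith

/-- Markov's inequality: each input on which `g` mispredicts `f` carries error at least ηc, by
`Strategy.score_gt`, while the average error is below ηc/4. -/
theorem Strategy.four_mul_card_lt (S : Strategy n q) (hη : 1 / 2 ≤ η) (h : S.RespondsWith f η)
    (hlow : condIncorrect (S.law f) < 1 / 4 * (1 - (labelWin η + 0.013)))
    {g : BitString n → BitString n → Bool}
    (hg : ∀ (x y : BitString n) (i : Bool) (A : POVM (Outside (S.sentA x) × Inside (S.sentB y)))
        (B : POVM (Outside (S.sentB y) × Inside (S.sentA x))),
        (1 + overlap) / 2 + 0.0016 < expect (S.exchanged x y) (scoreMatrix i A B) → g x y = i) :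
    4 * (Finset.univ.filter fun p : BitString n × BitString n => f p.1 p.2 ≠ g p.1 p.2).card <
      2 ^ (2 * n) := by
  have hη0 : 0 < η := by linarith
  set c := 1 - (labelWin η + 0.013) with hc
  -- A conditional probability below c/4 forces c > 0, so dividing by ηc is legitimate.
  have hcpos : 0 < c := by linarith [S.condIncorrect_nonneg hη0.le h]
  let bad (p : BitString n × BitString n) : ℝ :=
    S.lawAt f p.1 p.2 .wrong + S.lawAt f p.1 p.2 .abort
  have hbad0 : ∀ p, 0 ≤ bad p := fun p =>
    add_nonneg (wrongProb_nonneg _ _ _ _) (abortProb_nonneg _ _ _)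
  have hsum : ∑ p, bad p = 2 ^ (2 * n) * (η * condIncorrect (S.law f)) := by
    rw [condIncorrect, S.law_answer h, mul_div_cancel₀ _ hη0.ne']
    simp only [Strategy.law, bad, Fintype.sum_prod_type, Finset.sum_add_distrib]
    field_simp
  have hle : ((Finset.univ.filter fun p : BitString n × BitString n =>
      f p.1 p.2 ≠ g p.1 p.2).card : ℝ) * (η * c) ≤ ∑ p, bad p := by
    rw [← nsmul_eq_mul]
    refine (Finset.card_nsmul_le_sum _ bad (η * c) fun p hp => ?_).trans
      (Finset.sum_le_sum_of_subset_of_nonneg (Finset.subset_univ _) fun p _ _ => hbad0 p)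
    by_contra! hlt
    exact (Finset.mem_filter.1 hp).2
      (hg p.1 p.2 _ _ _ (S.score_gt hη h p.1 p.2 hlt)).symm
  have hlt : ((Finset.univ.filter fun p : BitString n × BitString n =>
      f p.1 p.2 ≠ g p.1 p.2).card : ℝ) * (η * c) < 2 ^ (2 * n) / 4 * (η * c) := by
    refine hle.trans_lt ?_
    rw [hsum]
    calc (2 : ℝ) ^ (2 * n) * (η * condIncorrect (S.law f)) < 2 ^ (2 * n) * (η * (1 / 4 * c)) := by
          gcongr
      _ = _ := by ring
  have := lt_of_mul_lt_mul_right hlt (by positivity)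
  have h4 : (4 : ℝ) * ((Finset.univ.filter fun p : BitString n × BitString n =>
      f p.1 p.2 ≠ g p.1 p.2).card : ℝ) < 2 ^ (2 * n) := by linarith
  exact_mod_cast h4

end Attack

/-! ### Hamming balls and comparison of exponents. -/

section Counting

/-- Volume of a Hamming ball of relative radius `1/4`. -/
theorem card_hamming_lt_quarter {X : Type*} [Fintype X] [DecidableEq X] (K : ℕ)
    (hX : Fintype.card X = 16 * K) (g : X → Bool) :
    (Finset.univ.filter fun f : X → Bool =>
      4 * (Finset.univ.filter fun x => f x ≠ g x).card < 16 * K).card ≤ 2 ^ (13 * K) := by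
  -- Chernoff weighting: each disagreement costs a factor 1/3, the odds (1/4)/(3/4) that are optimal
  -- for relative radius 1/4. Functions in the ball weigh at least (1/3)^(4K).
  have htot : ∑ f : X → Bool, ∏ x, (if f x ≠ g x then (1 / 3 : ℝ) else 1) = (4 / 3) ^ (16 * K) := by
    have := Finset.prod_univ_sum (fun _ : X => (Finset.univ : Finset Bool))
      fun x b => if b ≠ g x then (1 / 3 : ℝ) else 1
    rw [Fintype.piFinset_univ] at this
    rw [← this, ← hX, ← Finset.card_univ]
    refine Finset.prod_eq_pow_card fun x _ => ?_
    cases g x <;> norm_num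
  have hlow : ((Finset.univ.filter fun f : X → Bool =>
      4 * (Finset.univ.filter fun x => f x ≠ g x).card < 16 * K).card : ℝ) * (1 / 3) ^ (4 * K) ≤
      (4 / 3) ^ (16 * K) := by
    rw [← htot, ← nsmul_eq_mul]
    refine (Finset.card_nsmul_le_sum _ _ _ fun f hf => ?_).trans
      (Finset.sum_le_sum_of_subset_of_nonneg (Finset.subset_univ _) fun f _ _ =>
        Finset.prod_nonneg fun x _ => by split_ifs <;> norm_num)
    rw [Finset.prod_ite, Finset.prod_const, Finset.prod_const_one, mul_one]
    have := (Finset.mem_filter.1 hf).2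
    exact pow_le_pow_of_le_one (by norm_num) (by norm_num) (by omega)
  -- Per unit of K this is 2³² / 3¹² ≤ 2¹³, that is 8081.7… ≤ 8192.
  have h3 : (4 / 3 : ℝ) ^ (16 * K) ≤ 2 ^ (13 * K) * (1 / 3) ^ (4 * K) := by
    rw [pow_mul, pow_mul, pow_mul, ← mul_pow]
    exact pow_le_pow_left₀ (by norm_num) (by norm_num) _
  have := le_of_mul_le_mul_right (hlow.trans h3) (by positivity)
  exact_mod_cast this

theorem card_hamming_curried (n K : ℕ) (hK : 2 ^ (2 * n) = 16 * K)
    (g : BitString n → BitString n → Bool) :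
    (Finset.univ.filter fun f : BitString n → BitString n → Bool =>
      4 * (Finset.univ.filter fun p : BitString n × BitString n =>
        f p.1 p.2 ≠ g p.1 p.2).card < 2 ^ (2 * n)).card ≤ 2 ^ (13 * K) := by
  have hX : Fintype.card (BitString n × BitString n) = 16 * K := by
    rw [← hK]
    simp [two_mul, pow_add]
  refine le_trans (Finset.card_le_card_of_injOn Function.uncurry (fun f hf => ?_)
    Function.uncurry_injective.injOn) (card_hamming_lt_quarter K hX (Function.uncurry g))
  simp only [Finset.coe_filter, Finset.mem_univ, true_and, Set.mem_ofPred_eq] at hf ⊢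
  rw [← hK]
  exact hf

/-- Since 4^q ≤ 2^(n−10), the nets cost about 53/1024 of 2^(2n). With 13/16 for the ball this leaves
room for 2^n and for the 2q that pays for the choice of the register sizes. -/
theorem rounding_exponent_le {n q : ℕ} (h : 2 * q + 10 ≤ n) {qA qB : ℕ} (hA : qA ≤ q)
    (hB : qB ≤ q) : (2 * q + (52 * (2 ^ qA * 2 ^ qB) +
      (26 * (2 ^ qA) ^ 2 + 26 * (2 ^ qB) ^ 2 + qA + qB) * 2 ^ n)) + 13 * 2 ^ (2 * n - 4) + 2 ^ n ≤
      2 ^ (2 * n) := by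
  obtain ⟨k, rfl⟩ : ∃ k, n = k + 10 := ⟨n - 10, by omega⟩
  have hA' : 2 ^ qA ≤ 2 ^ q := Nat.pow_le_pow_right (by norm_num) hA
  have hB' : 2 ^ qB ≤ 2 ^ q := Nat.pow_le_pow_right (by norm_num) hB
  have hq : 2 ^ q * 2 ^ q ≤ 2 ^ k := by
    rw [← pow_add]; exact Nat.pow_le_pow_right (by norm_num) (by omega)
  have hk : k < 2 ^ k := Nat.lt_two_pow_self
  have e1 : 2 ^ (k + 10) = 1024 * 2 ^ k := by rw [pow_add]; ring
  have e2 : 2 ^ (2 * (k + 10)) = 1048576 * (2 ^ k * 2 ^ k) := by rw [two_mul, pow_add, e1]; ring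
  have e3 : 2 ^ (2 * (k + 10) - 4) = 65536 * (2 ^ k * 2 ^ k) := by
    rw [show 2 * (k + 10) - 4 = k + k + 16 by omega, pow_add, pow_add]; ring
  rw [e1, e2, e3]
  have h1 : 2 ^ qA * 2 ^ qB ≤ 2 ^ k := (Nat.mul_le_mul hA' hB').trans hq
  have h2 : (2 ^ qA) ^ 2 ≤ 2 ^ k := by rw [sq]; exact (Nat.mul_le_mul hA' hA').trans hq
  have h3 : (2 ^ qB) ^ 2 ≤ 2 ^ k := by rw [sq]; exact (Nat.mul_le_mul hB' hB').trans hq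
  generalize 2 ^ k = r at *
  have h4 : 26 * (2 ^ qA) ^ 2 + 26 * (2 ^ qB) ^ 2 + qA + qB ≤ 53 * r := by omega
  have h5 := Nat.mul_le_mul_right (1024 * r) h4
  have h6 : r ≤ r * r := Nat.le_mul_self r
  have h7 : 53 * r * (1024 * r) = 54272 * (r * r) := by ring
  omega

end Counting

/-! ### From counting insecure functions to the probability bound. -/

/-- The security property of `f` for a given bound on the winning probability. -/
theorem Strategy.secure_of_le {n q : ℕ} {f : BitString n → BitString n → Bool} {η : ℝ}
    (hη : 1 / 2 ≤ η) (S : Strategy n q) (h : S.RespondsWith f η)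
    (hS : 1 / 4 * (1 - (labelWin η + 0.013)) ≤ condIncorrect (S.law f)) {w : ℝ}
    (hw : labelWin η ≤ w) :
    1 / 4 * (1 - (w + 0.013)) ≤ condIncorrect (S.law f) ∧
      ∀ perr ∈ Set.Icc (0 : ℝ) 1, perr < 1 / 4 * (1 - (w + 0.013)) →
        condCorrect (S.law f) < condCorrect (honestLaw η perr) ∧
          condCorrect (honestLaw η perr) = 1 - perr := by
  have hη0 : η ≠ 0 := by linarith
  have hle : 1 / 4 * (1 - (w + 0.013)) ≤ condIncorrect (S.law f) := by linarith
  refine ⟨hle, fun perr _ hp => ?_⟩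
  have hhon : condCorrect (honestLaw η perr) = 1 - perr := by
    simp only [condCorrect, honestLaw]
    rw [show η * (1 - perr) + η * perr + 0 = η by ring]
    field_simp
  refine ⟨?_, hhon⟩
  rw [hhon, S.condCorrect_eq hη0 h]
  linarith

open Classical in
/-- All but few functions are secure against all strategies. -/
theorem card_insecure_le {n q : ℕ} (hq : 2 * q + 10 ≤ n) {η : ℝ} (hη : 1 / 2 ≤ η) :
    (Finset.univ.filter fun f : BitString n → BitString n → Bool =>
      ∃ S : Strategy n q, S.RespondsWith f η ∧
        condIncorrect (S.law f) < 1 / 4 * (1 - (labelWin η + 0.013))).card * 2 ^ 2 ^ n ≤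
      2 ^ 2 ^ (2 * n) := by
  choose G hGcard hG using exists_rounding n
  set K := 2 ^ (2 * n - 4) with hK
  have hK16 : 2 ^ (2 * n) = 16 * K := by
    rw [hK, show 2 * n = 4 + (2 * n - 4) by omega, pow_add]; simp
  let ball (g : BitString n → BitString n → Bool) :=
    Finset.univ.filter fun f : BitString n → BitString n → Bool =>
      4 * (Finset.univ.filter fun p : BitString n × BitString n =>
        f p.1 p.2 ≠ g p.1 p.2).card < 2 ^ (2 * n)
  let I := Finset.range (q + 1) ×ˢ Finset.range (q + 1)
  -- Union bound over register sizes and predictors; no attack strategy remains in the covering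
  -- sets.
  have hcover : (Finset.univ.filter fun f : BitString n → BitString n → Bool =>
      ∃ S : Strategy n q, S.RespondsWith f η ∧
        condIncorrect (S.law f) < 1 / 4 * (1 - (labelWin η + 0.013))) ⊆
      I.biUnion fun d => (G d.1 d.2).biUnion ball := by
    intro f hf
    obtain ⟨S, hS, hlow⟩ := (Finset.mem_filter.1 hf).2
    obtain ⟨g, hg, hgS⟩ := hG S.qA S.qB S.ψ S.isState S.UA S.UB S.sentA S.sentB
    refine Finset.mem_biUnion.2 ⟨(S.qA, S.qB), ?_, Finset.mem_biUnion.2 ⟨g, hg, ?_⟩⟩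
    · simp [I, S.qA_le, S.qB_le]
    · exact Finset.mem_filter.2 ⟨Finset.mem_univ _, S.four_mul_card_lt hη hS hlow hgS⟩
  have hI : I.card ≤ 2 ^ (2 * q) := by
    have : q + 1 ≤ 2 ^ q := Nat.lt_two_pow_self
    simp only [I, Finset.card_product, Finset.card_range, two_mul, pow_add]
    exact Nat.mul_le_mul this this
  have hbound : ∀ d ∈ I, ((G d.1 d.2).biUnion ball).card ≤
      2 ^ (2 ^ (2 * n) - 2 ^ n - 2 * q) := by
    intro d hd
    simp only [I, Finset.mem_product, Finset.mem_range, Nat.lt_succ_iff] at hd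
    calc _ ≤ (G d.1 d.2).card * 2 ^ (13 * K) :=
          Finset.card_biUnion_le_card_mul _ _ _ fun g _ => card_hamming_curried n K hK16 g
      _ ≤ _ := Nat.mul_le_mul_right _ (hGcard d.1 d.2)
      _ ≤ _ := by
        rw [← pow_add]
        refine Nat.pow_le_pow_right (by norm_num) ?_
        have := rounding_exponent_le hq hd.1 hd.2
        rw [← hK] at this
        omega
  have hexp : 2 * q + 2 ^ n ≤ 2 ^ (2 * n) := by
    have := rounding_exponent_le hq le_rfl le_rfl
    omega
  calc _ ≤ I.card * 2 ^ (2 ^ (2 * n) - 2 ^ n - 2 * q) * 2 ^ 2 ^ n :=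
        Nat.mul_le_mul_right _ ((Finset.card_le_card hcover).trans
          (Finset.card_biUnion_le_card_mul _ _ _ hbound))
    _ ≤ 2 ^ (2 * q) * 2 ^ (2 ^ (2 * n) - 2 ^ n - 2 * q) * 2 ^ 2 ^ n := by gcongr
    _ = _ := by
        rw [← pow_add, ← pow_add]
        congr 1
        omega

theorem one_sub_le_card_subtype_div {X : Type*} [Finite X] [Nonempty X] (bad : Finset X)
    {P : X → Prop} {c : ℝ} (h : ∀ f ∉ bad, P f) (hc : (bad.card : ℝ) ≤ c * Nat.card X) :
    1 - c ≤ (Nat.card {f // P f} : ℝ) / (Nat.card X : ℝ) := by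
  classical
  have := Fintype.ofFinite X
  have hsub : badᶜ ⊆ Finset.univ.filter P := fun f hf =>
    Finset.mem_filter.2 ⟨Finset.mem_univ f, h f (Finset.mem_compl.1 hf)⟩
  have hge : Nat.card X ≤ Nat.card {f // P f} + bad.card := by
    have h1 := Finset.card_le_card hsub
    rw [Finset.card_compl] at h1
    rw [Nat.card_eq_fintype_card, Nat.subtype_card (Finset.univ.filter P) (by simp)]
    omega
  have hge' : (Nat.card X : ℝ) ≤ Nat.card {f // P f} + bad.card := by exact_mod_cast hge
  rw [le_div_iff₀ (by exact_mod_cast Nat.card_pos), sub_mul, one_mul]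
  linarith

end LossyBB84

theorem mainTheorem1 (n q : ℕ) (hq : (q : ℝ) ≤ (n : ℝ) / 2 - 5)
    (η : ℝ) (hη : η ∈ Set.Ioc (0.509 : ℝ) 1) :
    1 - (2 : ℝ) ^ (-(2 : ℝ) ^ n) ≤
      (Nat.card {f : LossyBB84.BitString n → LossyBB84.BitString n → Bool //
        ∀ S : LossyBB84.Strategy n q, S.RespondsWith f η →
          ∀ w : ℝ,
            (w = LossyBB84.wTildeOpt 0.005 η ∨
              ∃ ℓ : ℕ, 1 ≤ ℓ ∧ w = LossyBB84.wTildeSDP ℓ 0.005 η) →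
            1 / 4 * (1 - (w + 0.013)) ≤ LossyBB84.condIncorrect (S.law f) ∧
            ∀ perr ∈ Set.Icc (0 : ℝ) 1, perr < 1 / 4 * (1 - (w + 0.013)) →
              LossyBB84.condCorrect (S.law f) <
                  LossyBB84.condCorrect (LossyBB84.honestLaw η perr) ∧
                LossyBB84.condCorrect (LossyBB84.honestLaw η perr) = 1 - perr} : ℝ) /
      (Nat.card (LossyBB84.BitString n → LossyBB84.BitString n → Bool) : ℝ) := by
  classical
  have hq' : 2 * q + 10 ≤ n := by
    have : (2 * q + 10 : ℝ) ≤ n := by linarith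
    exact_mod_cast this
  have hη2 : 1 / 2 ≤ η := by
    have := hη.1
    norm_num at this ⊢
    linarith
  have hcard := LossyBB84.card_insecure_le hq' hη2
  have htotal : Nat.card (LossyBB84.BitString n → LossyBB84.BitString n → Bool) =
      2 ^ 2 ^ (2 * n) := by
    rw [Nat.card_eq_fintype_card]
    simp only [Fintype.card_pi, Finset.prod_const, Fintype.card_bool, Finset.card_univ,
      Fintype.card_fin, ← pow_mul, ← pow_add, two_mul]
  refine LossyBB84.one_sub_le_card_subtype_div _ (fun f hf S hS w hw => ?_)
    (?_ : ((Finset.univ.filter fun f : LossyBB84.BitString n → LossyBB84.BitString n → Bool =>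
      ∃ S : LossyBB84.Strategy n q, S.RespondsWith f η ∧ LossyBB84.condIncorrect (S.law f) <
        1 / 4 * (1 - (LossyBB84.labelWin η + 0.013))).card : ℝ) ≤ _)
  · refine S.secure_of_le hη2 hS (not_lt.1 fun hlow => hf ?_) ?_
    · exact Finset.mem_filter.2 ⟨Finset.mem_univ _, S, hS, hlow⟩
    · rcases hw with rfl | ⟨ℓ, hℓ, rfl⟩
      · exact LossyBB84.labelWin_le_wTildeOpt (by norm_num) hη2 hη.2
      · exact LossyBB84.labelWin_le_wTildeSDP (by norm_num) hη2 hη.2 hℓ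
  · have hpow : (2 : ℝ) ^ (-(2 : ℝ) ^ n) = ((2 : ℝ) ^ 2 ^ n)⁻¹ := by
      rw [Real.rpow_neg (by norm_num), show (2 : ℝ) ^ n = ((2 ^ n : ℕ) : ℝ) by push_cast; rfl,
        Real.rpow_natCast]
    rw [hpow, inv_mul_eq_div, le_div_iff₀ (by positivity), htotal]
    exact_mod_cast hcard
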